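/- Let $F$ be a skew field and $n\ge 0$ an integer. Let $F[t]$ be the polynomial ring in an indeterminate $t$ commuting with $F$, and let $F(t)$ be its (Ore) skew field of fractions. Put $\deg(p/q)=\deg p-\deg q$ for nonzero $p,q\in F[t]$, put $\deg 0=-\infty$, and let $F(t)^-=\{x\in F(t):\deg x\le 0\}$ be the ring of proper elements. Regard $F(t)^n$ as the right $F(t)^-$-module of column vectors, and let $\mathcal L$ be the family of all $F(t)^-$-submodules $L\subseteq F(t)^n$ that are free of rank $n$, ordered by inclusion. For a nonsingular matrix $A$ over a skew field $K$, written in Bruhat normal form $A=LDPU$ with $L$ lower unitriangular, $U$ upper unitriangular, $P$ a permutation matrix and $D$ diagonal with nonzero diagonal entries $d_1,\dots,d_n$ ($DP$ being uniquely determined by $A$), the Dieudonné determinant is $\operatorname{Det}A=\operatorname{sgn}(P)\,d_1\cdots d_n$ modulo $[K^\times,K^\times]$. As $\deg$ vanishes on commutators, $\deg\operatorname{Det}A\in\mathbb Z$ is defined for nonsingular $A$ over $F(t)$. Then: 1. If $L,M\in\mathcal L$, then $L\cap M\in\mathcal L$ and $L+M\in\mathcal L$. Hence $\mathcal L$ is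 a lattice with $\wedge=\cap$ and $\vee=+$. 2. $\mathcal L$ is a uniform modular lattice. That is, $L\vee(M\wedge L')=(L\vee M)\wedge L'$ whenever $L\subseteq L'$; every chain in an interval of $\mathcal L$ is finite; for every $L\in\mathcal L$ the join $(L)^+$ of all elements of $\mathcal L$ covering $L$ exists; and the ascending operator $L\mapsto (L)^+$ is an automorphism of the lattice $\mathcal L$. 3. Every $L\in\mathcal L$ has the form $L=\{P\lambda : \lambda\in (F(t)^-)^n\}$ for a nonsingular matrix $P$ over $F(t)$, and $\deg L:=\deg\operatorname{Det}P$ does not depend on the choice of $P$. The function $\deg$ is a unit valuation on $\mathcal L$: one has $\deg L+\deg M=\deg(L\cap M)+\deg(L+M)$ for all $L,M\in\mathcal L$, $\deg L<\deg M$ if $L\subsetneq M$, and $\deg L=\deg M-1$ if $M$ covers $L$. 4. The uniform-rank of $\mathcal L$ is $n$: for every $L\in\mathcal L$, every maximal chain of the interval $[L,(L)^+]$ has length $n$ (that is, $n+1$ elements). 5. The ascending operator is $(L)^+=tL$ for every $L\in\mathcal L$. -/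

import Mathlib

open scoped Pointwise

noncomputable section

/-! ### The skew field `F(t)` of rational functions and the degree -/

namespace SkewRat

open Polynomial

/-- The left Ore condition for nonzero polynomials over a skew field (`t` is central). -/
theorem exists_mul_eq_mul {F : Type*} [DivisionRing F] :
    ∀ (N : ℕ) (p q : F[X]), p ≠ 0 → q ≠ 0 → p.natDegree + q.natDegree = N →
      ∃ a b : F[X], a ≠ 0 ∧ b ≠ 0 ∧ a * p = b * q := by
  intro N
  induction N using Nat.strong_induction_on with
  | _ N ih =>
    have key : ∀ p q : F[X], p ≠ 0 → q ≠ 0 → p.natDegree + q.natDegree = N →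
        q.natDegree ≤ p.natDegree → ∃ a b : F[X], a ≠ 0 ∧ b ≠ 0 ∧ a * p = b * q := by
      intro p q hp hq hN hle
      have hq' : q.leadingCoeff ≠ 0 := leadingCoeff_ne_zero.mpr hq
      have hp' : p.leadingCoeff ≠ 0 := leadingCoeff_ne_zero.mpr hp
      set m : F[X] := C (p.leadingCoeff * q.leadingCoeff⁻¹) * X ^ (p.natDegree - q.natDegree)
        with hm
      have hc : p.leadingCoeff * q.leadingCoeff⁻¹ ≠ 0 := mul_ne_zero hp' (inv_ne_zero hq')
      have hm0 : m ≠ 0 := mul_ne_zero (C_ne_zero.mpr hc) (pow_ne_zero _ X_ne_zero)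
      have hmd : m.natDegree = p.natDegree - q.natDegree := natDegree_C_mul_X_pow _ _ hc
      have hmq : (m * q).natDegree = p.natDegree := by
        rw [natDegree_mul hm0 hq, hmd]; omega
      have hml : (m * q).leadingCoeff = p.leadingCoeff := by
        rw [leadingCoeff_mul, hm, leadingCoeff_C_mul_X_pow, mul_assoc, inv_mul_cancel₀ hq', mul_one]
      by_cases h0 : p - m * q = 0
      · exact ⟨1, m, one_ne_zero, hm0, by rw [one_mul]; exact sub_eq_zero.mp h0⟩
      · have hlt : (p - m * q).degree < p.degree := by
          refine degree_sub_lt_left ?_ hp hml.symm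
          rw [degree_eq_natDegree hp, degree_eq_natDegree (mul_ne_zero hm0 hq), hmq]
        have hlt' := natDegree_lt_natDegree h0 hlt
        obtain ⟨a, b, ha, hb, hab⟩ := ih _ (by omega) (p - m * q) q h0 hq rfl
        have h1 : a * p = (b + a * m) * q := by
          rw [add_mul, ← hab, mul_sub, mul_assoc a m q, sub_add_cancel]
        refine ⟨a, b + a * m, ha, ?_, h1⟩
        intro h
        rw [h, zero_mul] at h1
        exact mul_ne_zero ha hp h1
    intro p q hp hq hN
    rcases le_total q.natDegree p.natDegree with h | h
    · exact key p q hp hq hN h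
    · obtain ⟨a, b, ha, hb, hab⟩ := key q p hq hp (by omega) h
      exact ⟨b, a, hb, ha, hab.symm⟩

/-- `F[t]` is an Ore domain. -/
instance oreSet (F : Type*) [DivisionRing F] :
    OreLocalization.OreSet (nonZeroDivisors F[X]) :=
  Classical.choice <| OreLocalization.nonempty_oreSet_iff_of_noZeroDivisors.mpr fun r s => by
    by_cases hr : r = 0
    · exact ⟨0, 1, by simp [hr]⟩
    · obtain ⟨a, b, ha, -, h⟩ :=
        exists_mul_eq_mul _ r s hr (nonZeroDivisors.ne_zero s.2) rfl
      exact ⟨b, ⟨a, mem_nonZeroDivisors_of_ne_zero ha⟩, h⟩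

/-- The skew field `F(t)` of fractions of `F[t]`, where `t` commutes with `F`. In Mathlib the
element `p /ₒ q` is the fraction `q⁻¹ * p`. For the Ore domain `F[t]` the left and the right
fractions give the same skew field. -/
abbrev RatFun (F : Type*) [DivisionRing F] : Type _ :=
  OreLocalization (nonZeroDivisors F[X]) F[X]

/-- The embedding of `F[t]` into `F(t)`. -/
def ofPoly {F : Type*} [DivisionRing F] (p : F[X]) : RatFun F :=
  OreLocalization.numeratorHom p

/-- The indeterminate `t` as an element of `F(t)`. -/
def t (F : Type*) [DivisionRing F] : RatFun F := ofPoly X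

open Classical in
/-- The degree on `F(t)`: the degree of the numerator minus the degree of the denominator;
`deg 0 = -∞`. -/
def deg {F : Type*} [DivisionRing F] : RatFun F → WithBot ℤ :=
  OreLocalization.liftExpand
    (fun p q => if p = 0 then ⊥ else
      (((p.natDegree : ℤ) - ((q : F[X]).natDegree : ℤ) : ℤ) : WithBot ℤ))
    (by
      intro p a q ha
      have ha0 : a ≠ 0 := by
        rintro rfl
        exact nonZeroDivisors.ne_zero ha (zero_mul _)
      have hq : (q : F[X]) ≠ 0 := nonZeroDivisors.ne_zero q.2
      by_cases hp : p = 0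
      · simp [hp]
      · have hap : a * p ≠ 0 := mul_ne_zero ha0 hp
        simp only [smul_eq_mul, hp, hap, if_false, natDegree_mul ha0 hp, natDegree_mul ha0 hq]
        congr 1
        push_cast
        ring)

theorem deg_oreDiv {F : Type*} [DivisionRing F] {p : F[X]} (hp : p ≠ 0)
    (q : nonZeroDivisors F[X]) :
    deg (p /ₒ q) = (((p.natDegree : ℤ) - ((q : F[X]).natDegree : ℤ) : ℤ) : WithBot ℤ) := by
  simp [deg, OreLocalization.liftExpand_of, hp]

theorem deg_zero {F : Type*} [DivisionRing F] : deg (0 : RatFun F) = ⊥ := by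
  rw [← OreLocalization.zero_oreDiv' (1 : nonZeroDivisors F[X]), deg,
    OreLocalization.liftExpand_of, if_pos rfl]

theorem deg_mul {F : Type*} [DivisionRing F] (x y : RatFun F) :
    deg (x * y) = deg x + deg y := by
  induction x using OreLocalization.ind with
  | _ p q =>
  induction y using OreLocalization.ind with
  | _ r s =>
  by_cases hp : p = 0
  · simp [hp, OreLocalization.zero_oreDiv', deg_zero]
  by_cases hr : r = 0
  · simp [hr, OreLocalization.zero_oreDiv', deg_zero]
  have hs0 : (s : F[X]) ≠ 0 := nonZeroDivisors.ne_zero s.2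
  have hq0 : (q : F[X]) ≠ 0 := nonZeroDivisors.ne_zero q.2
  obtain ⟨a, b, ha, hb, hab⟩ := exists_mul_eq_mul _ p s hp hs0 rfl
  rw [OreLocalization.oreDiv_mul_char p r q s b ⟨a, mem_nonZeroDivisors_of_ne_zero ha⟩ hab,
    deg_oreDiv (mul_ne_zero hb hr), deg_oreDiv hp, deg_oreDiv hr, ← WithBot.coe_add]
  have h := congrArg natDegree hab
  rw [natDegree_mul ha hp, natDegree_mul hb hs0] at h
  congr 1
  rw [Submonoid.coe_mul, natDegree_mul hb hr, natDegree_mul ha hq0]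
  push_cast
  omega

theorem deg_one {F : Type*} [DivisionRing F] : deg (1 : RatFun F) = 0 := by
  rw [OreLocalization.one_def, deg_oreDiv one_ne_zero]
  simp

theorem deg_add_le {F : Type*} [DivisionRing F] (x y : RatFun F) :
    deg (x + y) ≤ max (deg x) (deg y) := by
  induction x using OreLocalization.ind with
  | _ p q =>
  induction y using OreLocalization.ind with
  | _ r s =>
  by_cases hp : p = 0
  · simp [hp, OreLocalization.zero_oreDiv', deg_zero]
  by_cases hr : r = 0
  · simp [hr, OreLocalization.zero_oreDiv', deg_zero]
  have hs0 : (s : F[X]) ≠ 0 := nonZeroDivisors.ne_zero s.2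
  have hq0 : (q : F[X]) ≠ 0 := nonZeroDivisors.ne_zero q.2
  obtain ⟨a, b, ha, hb, hab⟩ := exists_mul_eq_mul _ (q : F[X]) (s : F[X]) hq0 hs0 rfl
  rw [OreLocalization.oreDiv_add_char q s b ⟨a, mem_nonZeroDivisors_of_ne_zero ha⟩ hab]
  have hsm : (⟨a, mem_nonZeroDivisors_of_ne_zero ha⟩ : nonZeroDivisors F[X]) • p = a * p := rfl
  rw [hsm, smul_eq_mul]
  by_cases h0 : a * p + b * r = 0
  · simp [h0, OreLocalization.zero_oreDiv', deg_zero]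
  rw [deg_oreDiv h0, deg_oreDiv hp, deg_oreDiv hr, ← WithBot.coe_max, WithBot.coe_le_coe]
  have h := congrArg natDegree hab
  rw [natDegree_mul ha hq0, natDegree_mul hb hs0] at h
  have h1 := natDegree_add_le (a * p) (b * r)
  rw [natDegree_mul ha hp, natDegree_mul hb hr] at h1
  rw [Submonoid.coe_mul, natDegree_mul ha hq0]
  push_cast
  omega

theorem deg_neg {F : Type*} [DivisionRing F] (x : RatFun F) : deg (-x) = deg x := by
  induction x using OreLocalization.ind with
  | _ p q =>
  rw [OreLocalization.neg_def]
  by_cases hp : p = 0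
  · simp [hp]
  · rw [deg_oreDiv (neg_ne_zero.mpr hp), deg_oreDiv hp, natDegree_neg]

theorem deg_ne_bot {F : Type*} [DivisionRing F] {x : RatFun F} (hx : x ≠ 0) : deg x ≠ ⊥ := by
  intro h
  have h1 := deg_mul x x⁻¹
  rw [mul_inv_cancel₀ hx, deg_one, h, WithBot.bot_add] at h1
  exact WithBot.coe_ne_bot h1

/-- The ring `F(t)⁻` of proper elements. -/
def proper (F : Type*) [DivisionRing F] : Subring (RatFun F) where
  carrier := {x | deg x ≤ 0}
  mul_mem' {x y} hx hy := by
    simp only [Set.mem_ofPred_eq] at hx hy ⊢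
    rw [deg_mul]
    exact add_nonpos hx hy
  one_mem' := deg_one.le
  add_mem' {x y} hx hy := (deg_add_le x y).trans (max_le hx hy)
  zero_mem' := by simp [deg_zero]
  neg_mem' {x} hx := by
    simp only [Set.mem_ofPred_eq] at hx ⊢
    rwa [deg_neg]

/-- The degree as a homomorphism from the multiplicative group of `F(t)` to `ℤ`. -/
def degUnits (F : Type*) [DivisionRing F] : (RatFun F)ˣ →* Multiplicative ℤ where
  toFun u := Multiplicative.ofAdd ((deg (u : RatFun F)).unbot (deg_ne_bot u.ne_zero))
  map_one' := by
    apply Multiplicative.toAdd.injective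
    apply WithBot.coe_injective
    simp [deg_one]
  map_mul' u v := by
    apply Multiplicative.toAdd.injective
    apply WithBot.coe_injective
    simp [deg_mul]

end SkewRat

/-! ### The Dieudonné determinant -/

/-- `A = L D P U` is a Bruhat normal form of `A` over a skew field `K`, where `D` is the diagonal
matrix with the nonzero diagonal entries `d i`, `P` is the permutation matrix of `σ`, and `L`
(resp. `U`) is lower (resp. upper) unitriangular. -/
structure IsBruhat {K : Type*} [DivisionRing K] {n : ℕ} (A : Matrix (Fin n) (Fin n) K)
    (L : Matrix (Fin n) (Fin n) K) (d : Fin n → Kˣ) (σ : Equiv.Perm (Fin n))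
    (U : Matrix (Fin n) (Fin n) K) : Prop where
  lower_diag : ∀ i, L i i = 1
  lower_zero : ∀ i j, i < j → L i j = 0
  upper_diag : ∀ i, U i i = 1
  upper_zero : ∀ i j, j < i → U i j = 0
  eq : A = L * Matrix.diagonal (fun i => (d i : K)) * σ.permMatrix K * U

open Classical in
/-- The Dieudonné determinant of a nonsingular matrix `A` over a skew field `K`, an element of the
abelianization of `Kˣ`: the class of `sgn(P) d₁ ⋯ dₙ`, where `A = L D P U` is a Bruhat normal form.
Such a form exists exactly for nonsingular `A`, and `D P` is uniquely determined.
The value is `1` (junk) for singular `A`. -/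
def dieudonneDet {K : Type*} [DivisionRing K] {n : ℕ} (A : Matrix (Fin n) (Fin n) K) :
    Abelianization Kˣ :=
  if h : ∃ x : (Fin n → Kˣ) × Equiv.Perm (Fin n), ∃ L U, IsBruhat A L x.1 x.2 U then
    Abelianization.of (Units.map (Int.castRingHom K : ℤ →* K) (Equiv.Perm.sign h.choose.2)) *
      ∏ i, Abelianization.of (h.choose.1 i)
  else 1

namespace SkewRat

/-- `deg Det A` for a nonsingular matrix `A` over `F(t)`. -/
def degDet {F : Type*} [DivisionRing F] {n : ℕ} (A : Matrix (Fin n) (Fin n) (RatFun F)) : ℤ :=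
  Multiplicative.toAdd (Abelianization.lift (degUnits F) (dieudonneDet A))

/-! ### Full-rank free submodules of `F(t)ⁿ` -/

/-- Right `F(t)⁻`-submodules of the space `F(t)ⁿ` of column vectors; a right module over a ring is
a left module over the opposite ring. -/
abbrev RightSubmodule (F : Type*) [DivisionRing F] (n : ℕ) : Type _ :=
  Submodule (proper F).op (Fin n → RatFun F)

/-- Full-rank free submodules: free modules of rank `n`. -/
def IsFullRankFree {F : Type*} [DivisionRing F] {n : ℕ} (L : RightSubmodule F n) : Prop :=
  Module.Free (proper F).op L ∧ Module.rank (proper F).op L = (n : Cardinal)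

/-- The family `𝓛_R(F(t)ⁿ)` of all full-rank free right `F(t)⁻`-submodules of `F(t)ⁿ`; as a
subtype it is ordered by inclusion. -/
abbrev FullRankFree (F : Type*) [DivisionRing F] (n : ℕ) : Type _ :=
  {L : RightSubmodule F n // IsFullRankFree L}

/-- `⟨P⟩ = {P x | x ∈ (F(t)⁻)ⁿ}`. -/
def colModule {F : Type*} [DivisionRing F] {n : ℕ} (P : Matrix (Fin n) (Fin n) (RatFun F)) :
    RightSubmodule F n where
  carrier := {v | ∃ x : Fin n → RatFun F, (∀ i, x i ∈ proper F) ∧ v = P.mulVec x}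
  add_mem' := by
    rintro _ _ ⟨x, hx, rfl⟩ ⟨y, hy, rfl⟩
    exact ⟨x + y, fun i => add_mem (hx i) (hy i), (Matrix.mulVec_add _ _ _).symm⟩
  zero_mem' := ⟨0, fun _ => zero_mem _, (Matrix.mulVec_zero _).symm⟩
  smul_mem' := by
    rintro c _ ⟨x, hx, rfl⟩
    refine ⟨c • x, fun i => ?_, (Matrix.mulVec_smul _ _ _).symm⟩
    exact mul_mem (hx i) c.2

open Classical in
/-- `deg L = deg Det P` for a nonsingular matrix `P` with `L = ⟨P⟩` (junk value `0` if there is no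
such `P`). -/
def latticeDeg {F : Type*} [DivisionRing F] {n : ℕ} (L : RightSubmodule F n) : ℤ :=
  if h : ∃ P : Matrix (Fin n) (Fin n) (RatFun F), IsUnit P ∧ L = colModule P then
    degDet h.choose
  else 0

end SkewRat

/-! ### Uniform modular lattices -/

/-- A uniform modular lattice: a modular lattice in which every chain of every interval is finite,
such that the ascending operator, which maps `x` to the join of all elements covering `x`, is
defined and is an automorphism. -/
structure IsUniformModularLattice (α : Type*) [Lattice α] : Prop where
  modular : ∀ x y z : α, x ≤ z → x ⊔ (y ⊓ z) = (x ⊔ y) ⊓ z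
  finite_chains : ∀ (x y : α) (C : Set α), C ⊆ Set.Icc x y → IsChain (· ≤ ·) C → C.Finite
  ascending : ∃ e : α ≃o α, ∀ x, IsLUB {y | x ⋖ y} (e x)

/-- The uniform-rank is `n`: for every `x`, with `x⁺` the join of the elements covering `x`, every
maximal chain of the interval `[x, x⁺]` has length `n`, i.e. `n + 1` elements. -/
def HasUniformRank (α : Type*) [Lattice α] (n : ℕ) : Prop :=
  ∀ x y : α, IsLUB {z | x ⋖ z} y →
    ∀ C : Set (Set.Icc x y), IsMaxChain (· ≤ ·) C → C.ncard = n + 1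

/-- Unit valuations on a lattice. -/
structure IsUnitValuation {α : Type*} [Lattice α] (v : α → ℝ) : Prop where
  modular_eq : ∀ x y, v x + v y = v (x ⊓ y) + v (x ⊔ y)
  strictMono : ∀ x y, x < y → v x < v y
  covBy : ∀ x y, x ⋖ y → v x = v y - 1

end

noncomputable section

/-! ### Arithmetic of the degree, of the central element `t` and of the proper ring. -/

namespace SkewRat

open Polynomial

variable {F : Type*} [DivisionRing F] {n : ℕ}

/-! The proper ring is a noncommutative discrete valuation ring with central uniformizer `t⁻¹`. Call
a submodule of `F(t)ⁿ` a lattice if it is finitely generated and some power of `t⁻¹` brings any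
given vector into it. The lattices are exactly the free submodules of rank `n`
(`isFullRankFree_iff_isLattice`): over a valuation ring a smallest generating system is independent,
and clearing denominators keeps it independent over `F(t)`. Sums, intersections (by Noetherianity)
and submodules between two lattices are again lattices, so the modular law and the covering relation
are those of all submodules.

The degree is a relative index. Intervals have finite length, so `[L : M]` is defined, additive in
chains and invariant under automorphisms. With `E` the standard lattice, `g ↦ [gE : E]` is therefore
a homomorphism from the general linear group to `ℤ`. It kills permutation matrices. It also kills
unitriangular ones: conjugating by suitable powers of `t` makes them congruent to `1` modulo `t⁻¹`,
and such matrices preserve `E` by Nakayama. On diagonal matrices it is the sum of the degrees.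
Evaluating it on a Bruhat form gives `deg Det P = [⟨P⟩ : E]` (`degDet_eq_relIndex`), so the degree
depends only on `⟨P⟩`, and the valuation identities reduce to the second isomorphism theorem and to
covers having simple quotients.

If `M` covers `L`, Nakayama forces `t⁻¹M ≤ L`; conversely each `x ∈ tL` outside `L` generates a
cover together with `L`. Hence `tL` is the join of the covers. Its degree exceeds that of `L` by
`n`, which is the length of every maximal chain in between. -/

theorem oreDiv_eq (p : F[X]) (q : nonZeroDivisors F[X]) :
    (p /ₒ q : RatFun F) = (ofPoly (q : F[X]))⁻¹ * ofPoly p := by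
  have hq : (ofPoly (q : F[X]) : RatFun F) ≠ 0 :=
    (OreLocalization.numerator_isUnit q).ne_zero
  rw [eq_inv_mul_iff_mul_eq₀ hq, ofPoly, ofPoly, OreLocalization.numeratorHom_apply,
    OreLocalization.numeratorHom_apply, OreLocalization.mul_cancel]

/-- Centrality passes from polynomials to fractions. It is what lets left scaling by powers of `t`
be read as right scaling. -/
theorem commute_t (x : RatFun F) : Commute (t F) x := by
  have h : ∀ p : F[X], Commute (t F) (ofPoly p) := fun p =>
    (Polynomial.commute_X p).map (OreLocalization.numeratorHom (S := nonZeroDivisors F[X]))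
  induction x using OreLocalization.ind with
  | _ p q =>
  rw [oreDiv_eq]
  exact (h _).inv_right₀.mul_right (h _)

theorem commute_t_zpow (k : ℤ) (x : RatFun F) : Commute (t F ^ k) x :=
  (commute_t x).zpow_left₀ k

theorem deg_t : deg (t F) = 1 := by
  rw [t, ofPoly, OreLocalization.numeratorHom_apply, deg_oreDiv X_ne_zero]
  simp

theorem t_ne_zero : t F ≠ 0 := by
  intro h
  have := deg_t (F := F)
  rw [h, deg_zero] at this
  exact absurd this (by simp)

theorem exists_deg_eq {x : RatFun F} (hx : x ≠ 0) : ∃ e : ℤ, deg x = e :=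
  ⟨_, (WithBot.coe_unbot _ (deg_ne_bot hx)).symm⟩

theorem deg_inv_of_eq {x : RatFun F} {e : ℤ} (h : deg x = e) : deg x⁻¹ = ((-e : ℤ) : WithBot ℤ) := by
  have hx : x ≠ 0 := by
    rintro rfl
    rw [deg_zero] at h
    exact WithBot.bot_ne_coe h
  obtain ⟨f, hf⟩ := exists_deg_eq (inv_ne_zero hx)
  have h1 := deg_mul x x⁻¹
  rw [mul_inv_cancel₀ hx, deg_one, h, hf, ← WithBot.coe_add, ← WithBot.coe_zero,
    WithBot.coe_inj] at h1
  rw [hf, WithBot.coe_inj]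
  omega

theorem deg_t_pow (k : ℕ) : deg (t F ^ k) = ((k : ℤ) : WithBot ℤ) := by
  induction k with
  | zero => simp [deg_one]
  | succ k ih => rw [pow_succ, deg_mul, ih, deg_t]; norm_cast

theorem deg_t_zpow (k : ℤ) : deg (t F ^ k) = (k : WithBot ℤ) := by
  obtain ⟨m, rfl | rfl⟩ := k.eq_nat_or_neg
  · rw [zpow_natCast, deg_t_pow]
  · rw [zpow_neg, zpow_natCast, deg_inv_of_eq (deg_t_pow m)]

theorem mem_proper {x : RatFun F} : x ∈ proper F ↔ deg x ≤ 0 := Iff.rfl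

theorem inv_t_mem_proper : (t F)⁻¹ ∈ proper F := by
  rw [mem_proper, deg_inv_of_eq (e := 1) (by rw [deg_t]; rfl)]
  exact WithBot.coe_le_coe.mpr (by norm_num)

theorem inv_mem_proper {x : RatFun F} (hx : deg x = 0) : x⁻¹ ∈ proper F := by
  rw [mem_proper, deg_inv_of_eq (e := 0) hx]
  simp

theorem t_mul_mem_proper {x : RatFun F} (hx : deg x < 0) : t F * x ∈ proper F := by
  by_cases h0 : x = 0
  · simp [h0, zero_mem]
  obtain ⟨e, he⟩ := exists_deg_eq h0
  rw [mem_proper, deg_mul, deg_t, he]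
  rw [he] at hx
  norm_cast at hx ⊢
  omega

theorem exists_inv_t_pow_mul_mem (x : RatFun F) : ∃ k : ℕ, ∀ m, k ≤ m →
    (t F)⁻¹ ^ m * x ∈ proper F := by
  by_cases h0 : x = 0
  · exact ⟨0, fun m _ => by simp [h0, zero_mem]⟩
  obtain ⟨e, he⟩ := exists_deg_eq h0
  refine ⟨e.toNat, fun m hm => ?_⟩
  rw [mem_proper, deg_mul, inv_pow, deg_inv_of_eq (deg_t_pow m), he]
  norm_cast
  omega

theorem exists_inv_t_pow_mul_mem_forall {ι : Type*} [Finite ι] (x : ι → RatFun F) :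
    ∃ k : ℕ, ∀ i, (t F)⁻¹ ^ k * x i ∈ proper F := by
  cases nonempty_fintype ι
  choose k hk using fun i => exists_inv_t_pow_mul_mem (x i)
  exact ⟨Finset.univ.sup k, fun i => hk i _ (Finset.le_sup (Finset.mem_univ i))⟩

/-- In a nonempty finite family with a nonzero entry, some nonzero entry has maximal degree. -/
theorem exists_forall_mul_inv_mem {ι : Type*} [Finite ι] (x : ι → RatFun F) {i₀ : ι}
    (h : x i₀ ≠ 0) : ∃ i, x i ≠ 0 ∧ ∀ j, x j * (x i)⁻¹ ∈ proper F := by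
  have : Nonempty ι := ⟨i₀⟩
  obtain ⟨i, hi⟩ := Finite.exists_max (fun i => deg (x i))
  have h0 : x i ≠ 0 := by
    intro h0
    have := hi i₀
    rw [h0, deg_zero, le_bot_iff] at this
    exact deg_ne_bot h this
  refine ⟨i, h0, fun j => ?_⟩
  by_cases hj : x j = 0
  · simp [hj, zero_mem]
  obtain ⟨e, he⟩ := exists_deg_eq h0
  obtain ⟨f, hf⟩ := exists_deg_eq hj
  have := hi j
  rw [he, hf, WithBot.coe_le_coe] at this
  rw [mem_proper, deg_mul, deg_inv_of_eq he, hf]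
  norm_cast
  omega

/-- An element of largest degree in a nonzero ideal divides all others, since the quotients are
proper. This supplies Noetherianity. -/
instance isPrincipalIdealRing_proper_op : IsPrincipalIdealRing (proper F).op where
  principal I := by
    by_cases hI : I = ⊥
    · subst hI; infer_instance
    obtain ⟨a, haI, ha⟩ := Submodule.exists_mem_ne_zero_of_ne_bot hI
    have hne : {m : ℕ | ∃ b ∈ I, deg (b : (RatFun F)ᵐᵒᵖ).unop = ((-m : ℤ) : WithBot ℤ)}.Nonempty := by
      have ha' : (a : (RatFun F)ᵐᵒᵖ).unop ≠ 0 := by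
        intro h
        exact ha (Subtype.ext (MulOpposite.unop_injective h))
      obtain ⟨e, he⟩ := exists_deg_eq ha'
      have h2 : deg (a : (RatFun F)ᵐᵒᵖ).unop ≤ 0 := a.2
      rw [he] at h2
      norm_cast at h2
      exact ⟨(-e).toNat, a, haI, by rw [he]; congr 1; omega⟩
    obtain ⟨b, hb, hdeg⟩ := Nat.sInf_mem hne
    set m := sInf {m : ℕ | ∃ b ∈ I, deg (b : (RatFun F)ᵐᵒᵖ).unop = ((-m : ℤ) : WithBot ℤ)}
    refine ⟨b, le_antisymm (fun c hc => ?_) ((Submodule.span_singleton_le_iff_mem _ _).mpr hb)⟩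
    have hb0 : (b : (RatFun F)ᵐᵒᵖ).unop ≠ 0 := by
      intro h
      rw [h, deg_zero] at hdeg
      exact WithBot.bot_ne_coe hdeg
    by_cases hc0 : (c : (RatFun F)ᵐᵒᵖ).unop = 0
    · have : c = 0 := Subtype.ext (MulOpposite.unop_injective hc0)
      rw [this]; exact zero_mem _
    obtain ⟨e, he⟩ := exists_deg_eq hc0
    have h2 : deg (c : (RatFun F)ᵐᵒᵖ).unop ≤ 0 := c.2
    rw [he] at h2
    norm_cast at h2
    have hm : m ≤ (-e).toNat := Nat.sInf_le ⟨c, hc, by rw [he]; congr 1; omega⟩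
    rw [Submodule.mem_span_singleton]
    refine ⟨⟨MulOpposite.op ((b : (RatFun F)ᵐᵒᵖ).unop⁻¹ * (c : (RatFun F)ᵐᵒᵖ).unop), ?_⟩, ?_⟩
    · change deg _ ≤ 0
      rw [MulOpposite.unop_op, deg_mul, deg_inv_of_eq hdeg, he]
      norm_cast
      omega
    · apply Subtype.ext
      apply MulOpposite.unop_injective
      change (b : (RatFun F)ᵐᵒᵖ).unop * _ = _
      rw [MulOpposite.unop_op, mul_inv_cancel_left₀ hb0]

end SkewRat

/-! ### Lattices and Nakayama's lemma. -/

namespace SkewRat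

variable {F : Type*} [DivisionRing F] {n : ℕ}

/-- The right `F(t)⁻`-lattices of `F(t)ⁿ`: finitely generated submodules which absorb every vector
after multiplication with a power of `t⁻¹`. -/
def IsLattice (L : RightSubmodule F n) : Prop :=
  L.FG ∧ ∀ v : Fin n → RatFun F, ∃ k : ℕ, (t F)⁻¹ ^ k • v ∈ L

theorem op_smul_apply {a : RatFun F} (ha : a ∈ proper F) (v : Fin n → RatFun F) (i : Fin n) :
    ((⟨MulOpposite.op a, ha⟩ : (proper F).op) • v) i = v i * a := rfl

theorem mul_right_mem {L : RightSubmodule F n} {v : Fin n → RatFun F} (hv : v ∈ L)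
    {a : RatFun F} (ha : a ∈ proper F) : (fun i => v i * a) ∈ L :=
  L.smul_mem (⟨MulOpposite.op a, ha⟩ : (proper F).op) hv

theorem inv_t_smul_mem {L : RightSubmodule F n} {v : Fin n → RatFun F} (hv : v ∈ L) :
    (t F)⁻¹ • v ∈ L := by
  convert mul_right_mem hv inv_t_mem_proper using 1
  funext i
  exact (commute_t (v i)).inv_left₀

theorem inv_t_pow_smul_mem {L : RightSubmodule F n} {v : Fin n → RatFun F} (hv : v ∈ L) (k : ℕ) :
    (t F)⁻¹ ^ k • v ∈ L := by
  induction k with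
  | zero => simpa
  | succ k ih => rw [pow_succ', mul_smul]; exact inv_t_smul_mem ih

theorem inv_t_pow_smul_mem_of_le {L : RightSubmodule F n} {v : Fin n → RatFun F} {k m : ℕ}
    (hv : (t F)⁻¹ ^ k • v ∈ L) (h : k ≤ m) : (t F)⁻¹ ^ m • v ∈ L := by
  obtain ⟨d, rfl⟩ := Nat.exists_eq_add_of_le' h
  rw [pow_add, mul_smul]
  exact inv_t_pow_smul_mem hv d

theorem inv_t_pow_smul_le (L : RightSubmodule F n) (k : ℕ) : (t F)⁻¹ ^ k • L ≤ L := by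
  intro v hv
  obtain ⟨w, hw, rfl⟩ := (Submodule.mem_smul_pointwise_iff_exists _ _ _).mp hv
  exact inv_t_pow_smul_mem hw k

theorem exists_inv_t_pow_smul_le {L M : RightSubmodule F n} (hL : L.FG)
    (hM : ∀ v : Fin n → RatFun F, ∃ k : ℕ, (t F)⁻¹ ^ k • v ∈ M) :
    ∃ k : ℕ, (t F)⁻¹ ^ k • L ≤ M := by
  obtain ⟨m, w, rfl⟩ := Submodule.fg_iff_exists_fin_generating_family.mp hL
  choose k hk using fun i => hM (w i)
  refine ⟨Finset.univ.sup k, ?_⟩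
  rw [Submodule.pointwise_smul_def, Submodule.map_le_iff_le_comap, Submodule.span_le]
  rintro _ ⟨i, rfl⟩
  exact inv_t_pow_smul_mem_of_le (hk i) (Finset.le_sup (Finset.mem_univ i))

/-- Nakayama's lemma for lattices. -/
theorem le_of_le_sup_inv_t_smul {L M : RightSubmodule F n} (hM : M.FG)
    (hL : ∀ v : Fin n → RatFun F, ∃ k : ℕ, (t F)⁻¹ ^ k • v ∈ L)
    (h : M ≤ L ⊔ (t F)⁻¹ • M) : M ≤ L := by
  obtain ⟨k, hk⟩ := exists_inv_t_pow_smul_le hM hL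
  -- Substituting the hypothesis into itself pushes the error term to `t⁻ᵐM`, which `L` swallows
  -- once `m = k`.
  have key : ∀ m : ℕ, M ≤ L ⊔ (t F)⁻¹ ^ m • M := by
    intro m
    induction m with
    | zero => simp
    | succ m ih =>
      refine ih.trans (sup_le le_sup_left ?_)
      refine (smul_mono_right ((t F)⁻¹ ^ m) h).trans ?_
      rw [Submodule.smul_sup', smul_smul, ← pow_succ]
      exact sup_le_sup_right (inv_t_pow_smul_le L m) _
  exact (key k).trans (sup_le le_rfl hk)

/-! ### The equivalent descriptions of lattices -/

/-- Take a generating system of smallest size. In a nontrivial relation, dividing by a coefficient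
of maximal degree leaves proper coefficients, so that generator is redundant. -/
theorem exists_linearIndependent_of_fg {L : RightSubmodule F n} (hL : L.FG) :
    ∃ (m : ℕ) (w : Fin m → Fin n → RatFun F), LinearIndependent (proper F).op w ∧
      Submodule.span (proper F).op (Set.range w) = L := by
  classical
  have hex : ∃ m : ℕ, ∃ w : Fin m → Fin n → RatFun F,
      Submodule.span (proper F).op (Set.range w) = L :=
    Submodule.fg_iff_exists_fin_generating_family.mp hL
  obtain ⟨w, hw⟩ := Nat.find_spec hex
  have hmin : ∀ k < Nat.find hex, ¬ _ := fun k hk => Nat.find_min hex hk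
  generalize Nat.find hex = m at w hw hmin
  refine ⟨m, w, ?_, hw⟩
  rw [Fintype.linearIndependent_iff]
  by_contra! hcon
  obtain ⟨g, hg, i₀, hi₀⟩ := hcon
  have hi₀' : (g i₀ : (RatFun F)ᵐᵒᵖ).unop ≠ 0 := fun h =>
    hi₀ (Subtype.ext (MulOpposite.unop_injective h))
  obtain ⟨i, hi, hmax⟩ := exists_forall_mul_inv_mem (fun i => (g i : (RatFun F)ᵐᵒᵖ).unop) hi₀'
  obtain ⟨m, rfl⟩ : ∃ k, m = k + 1 := ⟨m - 1, by have := i.pos; omega⟩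
  refine hmin m (Nat.lt_succ_self m) ⟨w ∘ i.succAbove, ?_⟩
  rw [← hw]
  refine le_antisymm (Submodule.span_mono (Set.range_comp_subset_range _ _)) ?_
  rw [Submodule.span_le]
  have hmem : ∀ j, w (i.succAbove j) ∈
      Submodule.span (proper F).op (Set.range (w ∘ i.succAbove)) :=
    fun j => Submodule.subset_span ⟨j, rfl⟩
  rintro _ ⟨j, rfl⟩
  rcases Fin.eq_self_or_eq_succAbove i j with rfl | ⟨j', rfl⟩
  · have hsum : w j = -∑ l, fun k => w (j.succAbove l) k *
        ((g (j.succAbove l) : (RatFun F)ᵐᵒᵖ).unop * (g j : (RatFun F)ᵐᵒᵖ).unop⁻¹) := by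
      funext k
      have h1 := congrFun hg k
      rw [Finset.sum_apply, Fin.sum_univ_succAbove _ j] at h1
      have h2 : w j k * (g j : (RatFun F)ᵐᵒᵖ).unop + ∑ l, w (j.succAbove l) k *
        (g (j.succAbove l) : (RatFun F)ᵐᵒᵖ).unop = 0 := h1
      have h3 : w j k = w j k * (g j : (RatFun F)ᵐᵒᵖ).unop * (g j : (RatFun F)ᵐᵒᵖ).unop⁻¹ :=
        (mul_inv_cancel_right₀ hi _).symm
      rw [Pi.neg_apply, Finset.sum_apply, h3, eq_neg_of_add_eq_zero_left h2]
      have h5 : ∀ a b : RatFun F, -a * b = -(a * b) :=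
        fun a b => neg_mul (α := RatFun F) a b
      rw [h5, Finset.sum_mul]
      simp only [mul_assoc]
    rw [hsum]
    exact neg_mem (sum_mem fun l _ => mul_right_mem (hmem l) (hmax _))
  · exact hmem j'

/-- A power of `t⁻¹` makes all coefficients of a relation proper and, being central, factors out of
it. -/
theorem LinearIndependent.op_ratFun {ι : Type*} [Finite ι] {w : ι → Fin n → RatFun F}
    (hw : LinearIndependent (proper F).op w) : LinearIndependent (RatFun F)ᵐᵒᵖ w := by
  cases nonempty_fintype ι
  rw [Fintype.linearIndependent_iff] at hw ⊢
  intro g hg i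
  obtain ⟨k, hk⟩ := exists_inv_t_pow_mul_mem_forall fun i => (g i).unop
  have h := hw (fun i => ⟨MulOpposite.op ((t F)⁻¹ ^ k * (g i).unop), hk i⟩) (by
    funext j
    have h1 : ∑ i, w i j * (g i).unop = 0 := by
      have := congrFun hg j
      rwa [Finset.sum_apply] at this
    rw [Finset.sum_apply]
    have h2 : ∀ i, ((⟨MulOpposite.op ((t F)⁻¹ ^ k * (g i).unop), hk i⟩ : (proper F).op) • w i) j =
        (t F)⁻¹ ^ k * (w i j * (g i).unop) := by
      intro i
      rw [op_smul_apply, ← mul_assoc, ← mul_assoc, ((commute_t (w i j)).inv_left₀.pow_left k).eq]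
    simp only [h2, ← Finset.mul_sum, h1, mul_zero, Pi.zero_apply]) i
  have h' : (t F)⁻¹ ^ k * (g i).unop = 0 := 
    congrArg (fun x : (proper F).op => (x : (RatFun F)ᵐᵒᵖ).unop) h
  have h3 := (mul_eq_zero.mp h').resolve_left (pow_ne_zero k (inv_ne_zero t_ne_zero))
  exact MulOpposite.unop_injective h3

variable (F n) in
/-- The standard basis of the right vector space `F(t)ⁿ`. -/
def stdBasis : Module.Basis (Fin n) (RatFun F)ᵐᵒᵖ (Fin n → RatFun F) :=
  Module.Basis.ofEquivFun
    { toFun := fun v i => MulOpposite.op (v i)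
      invFun := fun v i => (v i).unop
      map_add' := fun _ _ => rfl
      map_smul' := fun _ _ => rfl
      left_inv := fun _ => rfl
      right_inv := fun _ => rfl }

theorem finrank_ratFun : Module.finrank (RatFun F)ᵐᵒᵖ (Fin n → RatFun F) = n := by
  rw [Module.finrank_eq_card_basis (stdBasis F n), Fintype.card_fin]

theorem mulVec_eq_sum_smul (P : Matrix (Fin n) (Fin n) (RatFun F)) (x : Fin n → RatFun F) :
    P.mulVec x = ∑ j, MulOpposite.op (x j) • P.col j := by
  funext i
  rw [Finset.sum_apply]
  rfl

theorem colModule_eq_span (P : Matrix (Fin n) (Fin n) (RatFun F)) :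
    colModule P = Submodule.span (proper F).op (Set.range P.col) := by
  apply le_antisymm
  · rintro _ ⟨x, hx, rfl⟩
    rw [mulVec_eq_sum_smul]
    have hmem : ∀ j, P.col j ∈ Submodule.span (proper F).op (Set.range P.col) :=
      fun j => Submodule.subset_span (Set.mem_range_self j)
    exact sum_mem fun j _ => mul_right_mem (hmem j) (hx j)
  · rw [Submodule.span_le]
    rintro _ ⟨j, rfl⟩
    refine ⟨Pi.single j 1, fun i => ?_, ?_⟩
    · by_cases h : i = j
      · subst h; simp [one_mem]
      · simp [h, zero_mem]
    · rw [Matrix.mulVec_single_one]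

instance finite_ratFun : Module.Finite (RatFun F)ᵐᵒᵖ (Fin n → RatFun F) :=
  Module.Finite.of_basis (stdBasis F n)

/-- By dimension the columns span; solving for the standard basis vectors gives a right inverse, and
one side suffices over a skew field. -/
theorem isUnit_of_linearIndependent_col {P : Matrix (Fin n) (Fin n) (RatFun F)}
    (h : LinearIndependent (RatFun F)ᵐᵒᵖ P.col) : IsUnit P := by
  have hspan : Submodule.span (RatFun F)ᵐᵒᵖ (Set.range P.col) = ⊤ :=
    h.span_eq_top_of_card_eq_finrank' (by rw [finrank_ratFun, Fintype.card_fin])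
  have hsurj : ∀ v, ∃ x, P.mulVec x = v := by
    intro v
    have hv : v ∈ Submodule.span (RatFun F)ᵐᵒᵖ (Set.range P.col) := hspan ▸ Submodule.mem_top
    obtain ⟨c, rfl⟩ := (Submodule.mem_span_range_iff_exists_fun _).mp hv
    exact ⟨fun i => (c i).unop, mulVec_eq_sum_smul _ _⟩
  choose q hq using fun j : Fin n => hsurj (Pi.single j 1)
  refine IsUnit.of_mul_eq_one (Matrix.of fun i j => q j i) ?_
  ext i j
  have := congrFun (hq j) i
  rw [Matrix.one_apply, Matrix.mul_apply]
  rw [Pi.single_apply] at this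
  exact this

theorem linearIndependent_col {P : Matrix (Fin n) (Fin n) (RatFun F)} (h : IsUnit P) :
    LinearIndependent (proper F).op P.col := by
  rw [Fintype.linearIndependent_iff]
  intro g hg i
  obtain ⟨Q, hQ⟩ := h.exists_left_inv
  have h0 : P.mulVec (fun j => (g j : (RatFun F)ᵐᵒᵖ).unop) = 0 := by
    rw [mulVec_eq_sum_smul]; exact hg
  have h1 := congrArg Q.mulVec h0
  rw [Matrix.mulVec_mulVec, hQ, Matrix.one_mulVec, Matrix.mulVec_zero] at h1
  exact Subtype.ext (MulOpposite.unop_injective (congrFun h1 i))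

theorem isFullRankFree_colModule {P : Matrix (Fin n) (Fin n) (RatFun F)} (h : IsUnit P) :
    IsFullRankFree (colModule P) := by
  rw [colModule_eq_span]
  have b := Module.Basis.span (linearIndependent_col h)
  refine ⟨Module.Free.of_basis b, ?_⟩
  rw [rank_eq_card_basis b, Fintype.card_fin]

theorem _root_.Submodule.exists_linearIndependent_span_eq_of_free {R V : Type*} [Ring R]
    [StrongRankCondition R] [AddCommGroup V] [Module R V] {m : ℕ} (L : Submodule R V)
    [Module.Free R L] (h : Module.rank R L = m) :
    ∃ w : Fin m → V, LinearIndependent R w ∧ Submodule.span R (Set.range w) = L := by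
  have b := Module.Free.chooseBasis R L
  rw [Module.Free.rank_eq_card_chooseBasisIndex, Cardinal.mk_eq_nat_iff] at h
  obtain ⟨e⟩ := h
  have b' := b.reindex e
  refine ⟨fun i => b' i, b'.linearIndependent.map' L.subtype L.ker_subtype, ?_⟩
  have h1 := congrArg (Submodule.map L.subtype) b'.span_eq
  rw [Submodule.map_span, Submodule.map_top, Submodule.range_subtype, ← Set.range_comp] at h1
  exact h1

theorem IsFullRankFree.exists_eq_colModule {L : RightSubmodule F n} (h : IsFullRankFree L) :
    ∃ P : Matrix (Fin n) (Fin n) (RatFun F), IsUnit P ∧ L = colModule P := by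
  obtain ⟨hfree, hrank⟩ := h
  obtain ⟨w, hw, hspan⟩ := L.exists_linearIndependent_span_eq_of_free hrank
  refine ⟨Matrix.of fun i j => w j i,
    isUnit_of_linearIndependent_col (LinearIndependent.op_ratFun hw), ?_⟩
  rw [colModule_eq_span]
  exact hspan.symm

theorem isLattice_colModule {P : Matrix (Fin n) (Fin n) (RatFun F)} (h : IsUnit P) :
    IsLattice (colModule P) := by
  constructor
  · rw [colModule_eq_span]
    exact Submodule.fg_span (Set.finite_range _)
  · intro v
    obtain ⟨Q, hQ⟩ := h.exists_right_inv
    obtain ⟨k, hk⟩ := exists_inv_t_pow_mul_mem_forall (Q.mulVec v)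
    refine ⟨k, (t F)⁻¹ ^ k • Q.mulVec v, hk, ?_⟩
    -- `mulVec` is linear only for right scalars, so the left scaling is rewritten as a right one.
    have hc : ∀ w : Fin n → RatFun F,
        (t F)⁻¹ ^ k • w = MulOpposite.op ((t F)⁻¹ ^ k) • w := fun w =>
      funext fun i => (commute_t (w i)).inv_left₀.pow_left k
    rw [hc, hc, Matrix.mulVec_smul, Matrix.mulVec_mulVec, hQ, Matrix.one_mulVec]

/-- Absorption makes independent generators of `L` span `F(t)ⁿ`, so there are exactly `n` of them.
-/
theorem IsLattice.exists_eq_colModule {L : RightSubmodule F n} (h : IsLattice L) :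
    ∃ P : Matrix (Fin n) (Fin n) (RatFun F), IsUnit P ∧ L = colModule P := by
  obtain ⟨m, w, hw, hspan⟩ := exists_linearIndependent_of_fg h.1
  have hw' := LinearIndependent.op_ratFun hw
  have htop : ⊤ ≤ Submodule.span (RatFun F)ᵐᵒᵖ (Set.range w) := by
    intro v _
    obtain ⟨k, hk⟩ := h.2 v
    rw [← hspan] at hk
    have h1 := Submodule.span_le_restrictScalars (proper F).op (RatFun F)ᵐᵒᵖ (Set.range w) hk
    rw [Submodule.restrictScalars_mem] at h1
    have h2 := Submodule.smul_mem _ (MulOpposite.op (t F ^ k)) h1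
    convert h2 using 1
    funext i
    change v i = (t F)⁻¹ ^ k * v i * t F ^ k
    rw [mul_assoc, ← ((commute_t (v i)).pow_left k).eq, ← mul_assoc, inv_pow,
      inv_mul_cancel₀ (pow_ne_zero _ t_ne_zero), one_mul]
  have hm : m = n := by
    have := Module.finrank_eq_card_basis (Module.Basis.mk hw' htop)
    rw [finrank_ratFun, Fintype.card_fin] at this
    exact this.symm
  subst hm
  refine ⟨Matrix.of fun i j => w j i, isUnit_of_linearIndependent_col hw', ?_⟩
  rw [colModule_eq_span]
  exact hspan.symm

/-- This trades freeness for a condition visibly stable under the lattice operations. -/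
theorem isFullRankFree_iff_isLattice {L : RightSubmodule F n} :
    IsFullRankFree L ↔ IsLattice L := by
  constructor
  · intro h
    obtain ⟨P, hP, rfl⟩ := h.exists_eq_colModule
    exact isLattice_colModule hP
  · intro h
    obtain ⟨P, hP, rfl⟩ := h.exists_eq_colModule
    exact isFullRankFree_colModule hP

/-! ### Closure properties -/

theorem IsLattice.of_le_of_fg {L M : RightSubmodule F n} (hL : IsLattice L) (h : L ≤ M)
    (hM : M.FG) : IsLattice M :=
  ⟨hM, fun v => (hL.2 v).imp fun _ hk => h hk⟩

theorem fg_of_le {L M : RightSubmodule F n} (hM : M.FG) (h : L ≤ M) : L.FG := by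
  have := isNoetherian_of_fg_of_noetherian M hM
  exact (isNoetherian_submodule.mp this) L h

theorem IsLattice.sup {L M : RightSubmodule F n} (hL : IsLattice L) (hM : IsLattice M) :
    IsLattice (L ⊔ M) :=
  hL.of_le_of_fg le_sup_left (hL.1.sup hM.1)

theorem IsLattice.inf {L M : RightSubmodule F n} (hL : IsLattice L) (hM : IsLattice M) :
    IsLattice (L ⊓ M) := by
  refine ⟨fg_of_le hL.1 inf_le_left, fun v => ?_⟩
  obtain ⟨k, hk⟩ := hL.2 v
  obtain ⟨l, hl⟩ := hM.2 v
  exact ⟨max k l, inv_t_pow_smul_mem_of_le hk (le_max_left _ _),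
    inv_t_pow_smul_mem_of_le hl (le_max_right _ _)⟩

theorem IsLattice.of_mem_Icc {L M N : RightSubmodule F n} (hL : IsLattice L) (hM : IsLattice M)
    (h : L ≤ N) (h' : N ≤ M) : IsLattice N :=
  hL.of_le_of_fg h (fg_of_le hM.1 h')

end SkewRat

/-! ### Relative length of submodules -/

namespace Submodule

variable {R V : Type*} [Ring R] [AddCommGroup V] [Module R V]

/-- The length of `B / (A ∩ B)`. -/
def relLength (A B : Submodule R V) : ℕ∞ := Module.length R (B ⧸ A.comap B.subtype)

/-- Length is additive on the exact sequence `0 → B/A → C/A → C/B → 0`. -/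
theorem relLength_add {A B C : Submodule R V} (hAB : A ≤ B) (hBC : B ≤ C) :
    relLength A B + relLength B C = relLength A C := by
  have hle : A.comap C.subtype ≤ B.comap C.subtype := Submodule.comap_mono hAB
  have hle' : A.comap B.subtype ≤ (A.comap C.subtype).comap (Submodule.inclusion hBC) :=
    fun x hx => hx
  refine (Module.length_eq_add_of_exact (Submodule.mapQ _ _ (Submodule.inclusion hBC) hle')
    (Submodule.factor hle) ?_ (Submodule.factor_surjective hle) ?_).symm
  · rw [← LinearMap.ker_eq_bot, LinearMap.ker_eq_bot']
    intro x hx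
    induction x using Submodule.Quotient.induction_on with
    | H x =>
    rw [Submodule.mapQ_apply, Submodule.Quotient.mk_eq_zero] at hx
    exact (Submodule.Quotient.mk_eq_zero _).mpr hx
  · intro y
    induction y using Submodule.Quotient.induction_on with
    | H y =>
    change Submodule.Quotient.mk y = 0 ↔ _
    rw [Submodule.Quotient.mk_eq_zero]
    constructor
    · intro hy
      exact ⟨Submodule.Quotient.mk ⟨y, hy⟩, rfl⟩
    · rintro ⟨x, hx⟩
      induction x using Submodule.Quotient.induction_on with
      | H x =>
      rw [Submodule.mapQ_apply, Submodule.Quotient.eq] at hx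
      have h1 : (x : V) - y ∈ A := hx
      have h2 := B.sub_mem x.2 (hAB h1)
      rw [sub_sub_cancel] at h2
      exact h2

theorem relLength_inf_sup (A B : Submodule R V) : relLength (A ⊓ B) A = relLength B (A ⊔ B) :=
  (LinearMap.quotientInfEquivSupQuotient A B).length_eq

theorem relLength_map (e : V ≃ₗ[R] V) (A B : Submodule R V) :
    relLength (A.map (e : V →ₗ[R] V)) (B.map (e : V →ₗ[R] V)) = relLength A B := by
  refine (LinearEquiv.length_eq (Submodule.Quotient.equiv _ _ (e.submoduleMap B) ?_)).symm
  ext ⟨y, hy⟩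
  constructor
  · rintro ⟨x, hx, hxy⟩
    exact ⟨x, hx, congrArg Subtype.val hxy⟩
  · rintro ⟨x, hx, hxy⟩
    obtain ⟨z, hz, hzy⟩ := hy
    have hxz : x = z := e.injective (hxy.trans hzy.symm)
    subst hxz
    exact ⟨⟨x, hz⟩, hx, Subtype.ext hzy⟩

theorem relLength_eq_one_of_covBy {A B : Submodule R V} (h : A ⋖ B) : relLength A B = 1 :=
  Module.length_eq_one_iff.mpr ((covBy_iff_quot_is_simple h.le).mp h)

theorem relLength_self (A : Submodule R V) : relLength A A = 0 := by
  rw [relLength, Module.length_eq_zero_iff, Submodule.Quotient.subsingleton_iff]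
  exact Submodule.comap_subtype_self A

theorem relLength_ne_zero_of_lt {A B : Submodule R V} (h : A < B) : relLength A B ≠ 0 := by
  rw [relLength, Ne, Module.length_eq_zero_iff, Submodule.Quotient.subsingleton_iff,
    Submodule.comap_subtype_eq_top]
  exact not_le_of_gt h

end Submodule

/-! ### Covers and finiteness of length. -/

namespace SkewRat

open Submodule

variable {F : Type*} [DivisionRing F] {n : ℕ}

/-- Adjoining to `L` a vector `x ∉ L` with `t⁻¹x ∈ L` gives a cover of `L`. -/
theorem covBy_sup_span {L : RightSubmodule F n} {x : Fin n → RatFun F} (hx : x ∉ L)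
    (hx' : (t F)⁻¹ • x ∈ L) : L ⋖ L ⊔ Submodule.span (proper F).op {x} := by
  have hxm : x ∈ L ⊔ Submodule.span (proper F).op {x} :=
    Submodule.mem_sup_right (Submodule.mem_span_singleton_self x)
  refine ⟨lt_of_le_of_ne le_sup_left fun h => hx (by rw [h]; exact hxm), fun N hLN hN => ?_⟩
  obtain ⟨y, hyN, hyL⟩ := SetLike.exists_of_lt hLN
  obtain ⟨l, hl, z, hz, rfl⟩ := Submodule.mem_sup.mp (hN.le hyN)
  obtain ⟨⟨a, ha⟩, rfl⟩ := Submodule.mem_span_singleton.mp hz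
  have hdeg : deg a.unop ≤ 0 := ha
  -- If `deg a < 0`, then `x a = (t⁻¹x)(t a)` already lies in `L`; if `deg a = 0`, then `a` is a
  -- unit of the proper ring and `x` is recovered from `x a`.
  rcases hdeg.lt_or_eq with hlt | heq
  · refine hyL (L.add_mem hl ?_)
    have h1 := mul_right_mem hx' (t_mul_mem_proper hlt)
    convert h1 using 1
    funext i
    change x i * a.unop = (t F)⁻¹ * x i * (t F * a.unop)
    rw [← mul_assoc, ((commute_t (x i)).inv_left₀).eq, inv_mul_cancel_right₀ t_ne_zero]
  · have h0 : a.unop ≠ 0 := by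
      intro h0
      rw [h0, deg_zero] at heq
      exact WithBot.bot_ne_coe heq
    have hxa : (⟨a, ha⟩ : (proper F).op) • x ∈ N := (N.add_mem_iff_right (hLN.le hl)).mp hyN
    have h1 := mul_right_mem hxa (inv_mem_proper heq)
    have h2 : x ∈ N := by
      convert h1 using 1
      funext i
      change x i = x i * a.unop * a.unop⁻¹
      rw [mul_inv_cancel_right₀ h0]
    exact hN.not_ge (sup_le hLN.le ((Submodule.span_singleton_le_iff_mem _ _).mpr h2))

/-- Scale a vector of `M` outside `L` by the last power of `t⁻¹` that still keeps it outside. -/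
theorem IsLattice.exists_covBy_le {L M : RightSubmodule F n} (hL : IsLattice L) (h : L < M) :
    ∃ x ∈ M, L ⋖ L ⊔ Submodule.span (proper F).op {x} := by
  classical
  obtain ⟨x, hxM, hxL⟩ := SetLike.exists_of_lt h
  have hex := hL.2 x
  obtain ⟨k, hk⟩ : ∃ k, Nat.find hex = k + 1 := by
    refine Nat.exists_eq_succ_of_ne_zero fun h0 => hxL ?_
    have := Nat.find_spec hex
    rwa [h0, pow_zero, one_smul] at this
  refine ⟨(t F)⁻¹ ^ k • x, inv_t_pow_smul_mem hxM k,
    covBy_sup_span (Nat.find_min hex (by omega)) ?_⟩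
  have := Nat.find_spec hex
  rwa [hk, pow_succ', mul_smul] at this

/-- Climb from `L` by covers, each of length one; since `M` is Noetherian the climb stops, and it
can only stop at `M`. -/
theorem IsLattice.relLength_ne_top {L M : RightSubmodule F n} (hL : IsLattice L)
    (hM : IsLattice M) (h : L ≤ M) : relLength L M ≠ ⊤ := by
  have hN : IsNoetherian (proper F).op M := isNoetherian_of_fg_of_noetherian M hM.1
  have key : ∀ N : Submodule (proper F).op M, L ≤ N.map M.subtype →
      relLength (N.map M.subtype) M ≠ ⊤ := by
    intro N
    induction N using WellFoundedGT.induction with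
    | ind N ih =>
    intro hLN
    rcases (Submodule.map_subtype_le M N).eq_or_lt with heq | hlt
    · rw [heq, relLength_self]; exact ENat.zero_ne_top
    · have hNl : IsLattice (N.map M.subtype) := hL.of_mem_Icc hM hLN hlt.le
      obtain ⟨x, hxM, hcov⟩ := hNl.exists_covBy_le hlt
      have hmap : (N ⊔ Submodule.span (proper F).op {⟨x, hxM⟩}).map M.subtype =
          N.map M.subtype ⊔ Submodule.span (proper F).op {x} := by
        rw [Submodule.map_sup, Submodule.map_span, Set.image_singleton]; rfl
      have hlt' : N < N ⊔ Submodule.span (proper F).op {⟨x, hxM⟩} := by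
        refine lt_of_le_of_ne le_sup_left fun h => hcov.lt.ne ?_
        rw [← hmap, ← h]
      have h1 := ih _ hlt' (hmap ▸ hLN.trans le_sup_left)
      rw [hmap] at h1
      have hle : N.map M.subtype ⊔ Submodule.span (proper F).op {x} ≤ M :=
        sup_le hlt.le ((Submodule.span_singleton_le_iff_mem _ _).mpr hxM)
      rw [← relLength_add hcov.le hle, relLength_eq_one_of_covBy hcov]
      exact WithTop.add_ne_top.mpr ⟨ENat.one_ne_top, h1⟩
  have := key (L.comap M.subtype)
  rw [Submodule.map_comap_subtype, inf_eq_right.mpr h] at this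
  exact this le_rfl

/-! ### The relative index of lattices -/

/-- The relative index `[L : M]` of two lattices. -/
def relIndex (L M : RightSubmodule F n) : ℤ :=
  ((relLength (L ⊓ M) L).toNat : ℤ) - ((relLength (L ⊓ M) M).toNat : ℤ)

theorem IsLattice.toNat_relLength_add {L M N : RightSubmodule F n} (hL : IsLattice L)
    (hM : IsLattice M) (hN : IsLattice N) (h : L ≤ M) (h' : M ≤ N) :
    (relLength L M).toNat + (relLength M N).toNat = (relLength L N).toNat := by
  rw [← relLength_add h h', ENat.toNat_add (hL.relLength_ne_top hM h) (hM.relLength_ne_top hN h')]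

/-- Any common sublattice may replace the intersection, so several indices can be measured from one
base. -/
theorem IsLattice.relIndex_eq {X L M : RightSubmodule F n} (hX : IsLattice X) (hL : IsLattice L)
    (hM : IsLattice M) (h : X ≤ L) (h' : X ≤ M) :
    relIndex L M = ((relLength X L).toNat : ℤ) - ((relLength X M).toNat : ℤ) := by
  have h1 := hX.toNat_relLength_add (hL.inf hM) hL (le_inf h h') inf_le_left
  have h2 := hX.toNat_relLength_add (hL.inf hM) hM (le_inf h h') inf_le_right
  rw [relIndex]
  omega

theorem IsLattice.relIndex_add {L M N : RightSubmodule F n} (hL : IsLattice L)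
    (hM : IsLattice M) (hN : IsLattice N) : relIndex L M + relIndex M N = relIndex L N := by
  have hX := (hL.inf hM).inf hN
  rw [hX.relIndex_eq hL hM (inf_le_left.trans inf_le_left) (inf_le_left.trans inf_le_right),
    hX.relIndex_eq hM hN (inf_le_left.trans inf_le_right) inf_le_right,
    hX.relIndex_eq hL hN (inf_le_left.trans inf_le_left) inf_le_right]
  omega

theorem relIndex_of_le {L M : RightSubmodule F n} (h : L ≤ M) :
    relIndex M L = ((relLength L M).toNat : ℤ) := by
  rw [relIndex, inf_eq_right.mpr h, relLength_self]
  simp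

theorem relIndex_self (L : RightSubmodule F n) : relIndex L L = 0 := sub_self _

theorem relIndex_map (e : (Fin n → RatFun F) ≃ₗ[(proper F).op] (Fin n → RatFun F))
    (L M : RightSubmodule F n) :
    relIndex (L.map (e : (Fin n → RatFun F) →ₗ[(proper F).op] (Fin n → RatFun F)))
      (M.map (e : (Fin n → RatFun F) →ₗ[(proper F).op] (Fin n → RatFun F))) = relIndex L M := by
  rw [relIndex, ← Submodule.map_inf _ e.injective, relLength_map, relLength_map, relIndex]

/-- By the second isomorphism theorem `[L : L ∩ M] = [L + M : M]`; additivity of the index does the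
rest. -/
theorem IsLattice.relIndex_inf_sup {L M N : RightSubmodule F n} (hL : IsLattice L)
    (hM : IsLattice M) (hN : IsLattice N) :
    relIndex L N + relIndex M N = relIndex (L ⊓ M) N + relIndex (L ⊔ M) N := by
  have h1 := hL.relIndex_add (hL.inf hM) hN
  have h2 := (hL.sup hM).relIndex_add hM hN
  rw [relIndex_of_le inf_le_left, relLength_inf_sup] at h1
  rw [relIndex_of_le le_sup_right] at h2
  omega

theorem IsLattice.relIndex_lt {L M N : RightSubmodule F n} (hL : IsLattice L)
    (hM : IsLattice M) (hN : IsLattice N) (h : L < M) : relIndex L N < relIndex M N := by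
  have h1 := hM.relIndex_add hL hN
  rw [relIndex_of_le h.le] at h1
  have h2 : (relLength L M).toNat ≠ 0 := by
    rw [Ne, ENat.toNat_eq_zero, not_or]
    exact ⟨relLength_ne_zero_of_lt h, hL.relLength_ne_top hM h.le⟩
  omega

theorem IsLattice.relIndex_of_covBy {L M N : RightSubmodule F n} (hL : IsLattice L)
    (hM : IsLattice M) (hN : IsLattice N) (h : L ⋖ M) : relIndex M N = relIndex L N + 1 := by
  have h1 := hM.relIndex_add hL hN
  rw [relIndex_of_le h.le, relLength_eq_one_of_covBy h] at h1
  simp at h1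
  omega

end SkewRat

/-! ### Existence of the Bruhat normal form -/

namespace Matrix

variable {K : Type*} [DivisionRing K] {n : ℕ}

/-- Lower unitriangular matrices. -/
def IsLowerUnitriangular (L : Matrix (Fin n) (Fin n) K) : Prop :=
  (∀ i, L i i = 1) ∧ ∀ i j, i < j → L i j = 0

theorem isLowerUnitriangular_one : IsLowerUnitriangular (1 : Matrix (Fin n) (Fin n) K) :=
  ⟨fun i => one_apply_eq i, fun _ _ h => one_apply_ne h.ne⟩

theorem IsLowerUnitriangular.mul {A B : Matrix (Fin n) (Fin n) K} (hA : IsLowerUnitriangular A)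
    (hB : IsLowerUnitriangular B) : IsLowerUnitriangular (A * B) := by
  refine ⟨fun i => ?_, fun i j hij => ?_⟩
  · rw [mul_apply, Finset.sum_eq_single i, hA.1, hB.1, one_mul]
    · intro k _ hk
      rcases lt_or_gt_of_ne hk with h | h
      · rw [hB.2 k i h, mul_zero]
      · rw [hA.2 i k h, zero_mul]
    · simp
  · rw [mul_apply]
    refine Finset.sum_eq_zero fun k _ => ?_
    rcases lt_or_ge i k with h | h
    · rw [hA.2 i k h, zero_mul]
    · rw [hB.2 k j (h.trans_lt hij), mul_zero]

theorem isLowerUnitriangular_transpose_mul {A B : Matrix (Fin n) (Fin n) K}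
    (hA : IsLowerUnitriangular Aᵀ) (hB : IsLowerUnitriangular Bᵀ) :
    IsLowerUnitriangular (A * B)ᵀ := by
  have hA2 : ∀ i j, j < i → A i j = 0 := fun i j h => hA.2 j i h
  have hB2 : ∀ i j, j < i → B i j = 0 := fun i j h => hB.2 j i h
  have hA1 : ∀ i, A i i = 1 := hA.1
  have hB1 : ∀ i, B i i = 1 := hB.1
  refine ⟨fun i => ?_, fun j i hij => ?_⟩
  · rw [transpose_apply, mul_apply, Finset.sum_eq_single i, hA1, hB1, one_mul]
    · intro k _ hk
      rcases lt_or_gt_of_ne hk with h | h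
      · rw [hA2 i k h, zero_mul]
      · rw [hB2 k i h, mul_zero]
    · simp
  · rw [transpose_apply, mul_apply]
    refine Finset.sum_eq_zero fun k _ => ?_
    rcases lt_or_ge k i with h | h
    · rw [hA2 i k h, zero_mul]
    · rw [hB2 k j (hij.trans_le h), mul_zero]

/-- The matrices reached after the elimination of the first `k` columns: `B` is equivalent to `A`
under unitriangular matrices, and its `j`-th column, for `j < k`, has the pivot row `r j`. -/
structure IsPartialBruhat (A B : Matrix (Fin n) (Fin n) K) (r : Fin n → Fin n) (k : ℕ) : Prop where
  exists_eq : ∃ L U, IsLowerUnitriangular L ∧ IsLowerUnitriangular Uᵀ ∧ A = L * B * U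
  col : ∀ j : Fin n, (j : ℕ) < k → ∀ i, B i j ≠ 0 ↔ i = r j
  row : ∀ j : Fin n, (j : ℕ) < k → ∀ j', B (r j) j' ≠ 0 → j' = j

/-- Pivoting on the topmost nonzero entry of the next column means that clearing the column takes
only lower unitriangular row operations. The pivot row vanishes in the earlier columns, so clearing
it takes only upper unitriangular column operations. -/
theorem exists_isPartialBruhat {A : Matrix (Fin n) (Fin n) K} (hA : IsUnit A) (k : ℕ)
    (hk : k ≤ n) : ∃ B r, IsUnit B ∧ IsPartialBruhat A B r k := by
  induction k with
  | zero =>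
    exact ⟨A, id, hA, ⟨1, 1, isLowerUnitriangular_one, by
      rw [transpose_one]; exact isLowerUnitriangular_one, by simp⟩, by simp, by simp⟩
  | succ k ih =>
    obtain ⟨B, r, hB, ⟨L, U, hL, hU, hAB⟩, hcol, hrow⟩ := ih (by omega)
    let c : Fin n := ⟨k, hk⟩
    have hne : ∃ i, B i c ≠ 0 := by
      by_contra! h
      obtain ⟨Q, hQ⟩ := hB.exists_left_inv
      have h1 := congrFun (congrFun hQ c) c
      rw [mul_apply, one_apply_eq] at h1
      simp [h] at h1
    obtain ⟨p, hp, hmin⟩ := WellFounded.has_min (wellFounded_lt (α := Fin n)) {i | B i c ≠ 0} hne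
    have hp' : B p c ≠ 0 := hp
    have hzero : ∀ i, i < p → B i c = 0 := fun i hi => by
      by_contra h; exact hmin i h hi
    -- An old pivot row is zero in column `c`, so `p` is a new row.
    have hpr : ∀ j : Fin n, (j : ℕ) < k → B p j = 0 := fun j hj => by
      by_contra h
      have h1 := (hcol j hj p).mp h
      subst h1
      have := hrow j hj c hp'
      rw [← this] at hj
      exact lt_irrefl _ hj
    have hrc : ∀ j : Fin n, (j : ℕ) < k → B (r j) c = 0 := fun j hj => by
      by_contra h
      have := hrow j hj c h
      rw [← this] at hj
      exact lt_irrefl _ hj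
    -- the multipliers clearing the column `c` below, and the row `p` to the right of, the pivot
    let a : Fin n → K := fun i => if i = p then 0 else B i c * (B p c)⁻¹
    let b : Fin n → K := fun j => if j = c then 0 else (B p c)⁻¹ * B p j
    have ha : a p = 0 := if_pos rfl
    have hb : b c = 0 := if_pos rfl
    let S : Matrix (Fin n) (Fin n) K := vecMulVec a (Pi.single p 1)
    let T : Matrix (Fin n) (Fin n) K := vecMulVec (Pi.single c 1) b
    -- Square zero makes `1 - S` the inverse of `1 + S`; likewise for `T`.
    have hSS : S * S = 0 := by
      ext i j
      simp [S, mul_apply, vecMulVec_apply, Pi.single_apply, ha]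
    have hTT : T * T = 0 := by
      ext i j
      simp [T, mul_apply, vecMulVec_apply, Pi.single_apply, hb]
    have hS1 : (1 + S) * (1 - S) = 1 := by noncomm_ring; simp [hSS]
    have hS2 : (1 - S) * (1 + S) = 1 := by noncomm_ring; simp [hSS]
    have hT1 : (1 + T) * (1 - T) = 1 := by noncomm_ring; simp [hTT]
    have hT2 : (1 - T) * (1 + T) = 1 := by noncomm_ring; simp [hTT]
    have hBS : ∀ i j, ((1 - S) * B) i j = B i j - a i * B p j := by
      intro i j
      rw [sub_mul, one_mul, sub_apply, mul_apply]
      simp [S, vecMulVec_apply, Pi.single_apply]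
    have hB' : ∀ i j, ((1 - S) * B * (1 - T)) i j =
        (B i j - a i * B p j) - (B i c - a i * B p c) * b j := by
      intro i j
      rw [mul_sub, mul_one, sub_apply, hBS, mul_apply (M := (1 - S) * B)]
      simp only [hBS]
      simp [T, vecMulVec_apply, Pi.single_apply]
    have hclear : ∀ i, i ≠ p → B i c - a i * B p c = 0 := fun i hi => by
      simp [a, hi, inv_mul_cancel_right₀ hp']
    have hpiv : B p c - a p * B p c = B p c := by rw [ha, zero_mul, sub_zero]
    have hrowp : ∀ j, j ≠ c → ((1 - S) * B * (1 - T)) p j = 0 := fun j hj => by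
      rw [hB', hpiv, ha, zero_mul, sub_zero]
      simp [b, hj, mul_inv_cancel_left₀ hp']
    have hold : ∀ j : Fin n, (j : ℕ) < k → ∀ i, ((1 - S) * B * (1 - T)) i j = B i j := by
      intro j hj i
      have hbj : b j = 0 := by simp [b, hpr j hj]
      rw [hB', hpr j hj, hbj]
      simp
    have hlt : ∀ j : Fin n, (j : ℕ) < k + 1 → j ≠ c → (j : ℕ) < k := fun j hj hjc => by
      have : (j : ℕ) ≠ k := fun h => hjc (Fin.ext h)
      omega
    refine ⟨(1 - S) * B * (1 - T), Function.update r c p, ?_, ⟨?_, ?_, ?_⟩⟩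
    · exact ((IsUnit.of_mul_eq_one _ hS2).mul hB).mul (IsUnit.of_mul_eq_one _ hT2)
    · refine ⟨L * (1 + S), (1 + T) * U, hL.mul ⟨fun i => ?_, fun i j hij => ?_⟩,
        isLowerUnitriangular_transpose_mul ⟨fun i => ?_, fun j i hij => ?_⟩ hU, ?_⟩
      · by_cases h : i = p
        · subst h; simp [S, vecMulVec_apply, ha]
        · simp [S, vecMulVec_apply, h]
      · by_cases h : j = p
        · subst h
          simp [S, vecMulVec_apply, a, hij.ne, hzero i hij]
        · simp [S, vecMulVec_apply, h, hij.ne]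
      · by_cases h : i = c
        · subst h; simp [T, vecMulVec_apply, hb]
        · simp [T, vecMulVec_apply, h]
      · rw [transpose_apply]
        by_cases h : i = c
        · subst h
          have hjk : (j : ℕ) < k := hij
          simp [T, vecMulVec_apply, b, hij.ne', hpr j hjk]
        · simp [T, vecMulVec_apply, h, hij.ne']
      · calc A = L * B * U := hAB
          _ = L * ((1 + S) * (1 - S)) * B * ((1 - T) * (1 + T)) * U := by
            rw [hS1, hT2, mul_one, mul_one]
          _ = _ := by simp only [Matrix.mul_assoc]
    · intro j hj i
      by_cases hjc : j = c
      · subst hjc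
        rw [hB', hb, mul_zero, sub_zero, Function.update_self]
        by_cases hi : i = p
        · subst hi; rw [hpiv]; simpa using hp'
        · rw [hclear i hi]; simpa using hi
      · rw [hold j (hlt j hj hjc), Function.update_of_ne hjc]
        exact hcol j (hlt j hj hjc) i
    · intro j hj j'
      by_cases hjc : j = c
      · subst hjc
        rw [Function.update_self]
        intro h
        by_contra hne
        exact h (hrowp j' hne)
      · have hjk := hlt j hj hjc
        rw [Function.update_of_ne hjc]
        have har : a (r j) = 0 := by simp [a, hrc j hjk]
        rw [hB', har, hrc j hjk]
        simpa using hrow j hjk j'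

end Matrix

/-- After all `n` columns each has a single nonzero entry, in distinct rows, so what remains is
monomial. -/
theorem exists_isBruhat {K : Type*} [DivisionRing K] {n : ℕ} {A : Matrix (Fin n) (Fin n) K}
    (hA : IsUnit A) : ∃ x : (Fin n → Kˣ) × Equiv.Perm (Fin n), ∃ L U, IsBruhat A L x.1 x.2 U := by
  obtain ⟨B, r, -, ⟨L, U, hL, hU, hAB⟩, hcol, hrow⟩ :=
    Matrix.exists_isPartialBruhat hA n le_rfl
  have hinj : Function.Injective r := fun j j' h =>
    (hrow j j.2 j' (h ▸ (hcol j' j'.2 (r j')).mpr rfl)).symm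
  let σ : Equiv.Perm (Fin n) := Equiv.ofBijective r (Finite.injective_iff_bijective.mp hinj)
  have hσ : ∀ j, σ j = r j := fun j => rfl
  have hd : ∀ i, B i (σ.symm i) ≠ 0 := fun i =>
    (hcol _ (σ.symm i).2 i).mpr (by rw [← hσ, Equiv.apply_symm_apply])
  -- `permMatrix` sends a row to its column while `r` sends a column to its row; hence the inverse.
  refine ⟨(fun i => Units.mk0 _ (hd i), σ.symm), L, U, hL.1, hL.2, hU.1, fun i j h => hU.2 j i h, ?_⟩
  rw [hAB, Matrix.mul_assoc L (Matrix.diagonal _)]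
  congr 2
  ext i j
  rw [Matrix.diagonal_mul, Equiv.Perm.permMatrix, PEquiv.toMatrix_apply]
  simp only [Units.val_mk0, Equiv.toPEquiv_apply, Option.mem_def, Option.some.injEq]
  split_ifs with h
  · rw [mul_one, ← h]
  · rw [mul_zero]
    by_contra hne
    exact h (by rw [(hcol j j.2 i).mp hne, ← hσ, Equiv.symm_apply_apply])


namespace SkewRat

open Submodule

variable {F : Type*} [DivisionRing F] {n : ℕ}

/-! ### The degree of the Dieudonné determinant as a relative index -/

theorem mem_colModule_one {v : Fin n → RatFun F} :
    v ∈ colModule (1 : Matrix (Fin n) (Fin n) (RatFun F)) ↔ ∀ i, v i ∈ proper F := by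
  constructor
  · rintro ⟨x, hx, rfl⟩ i
    rw [Matrix.one_mulVec]
    exact hx i
  · intro h
    exact ⟨v, h, (Matrix.one_mulVec v).symm⟩

/-- The linear automorphism of the right module `F(t)ⁿ` given by a nonsingular matrix. -/
def mulVecEquiv (g : (Matrix (Fin n) (Fin n) (RatFun F))ˣ) :
    (Fin n → RatFun F) ≃ₗ[(proper F).op] (Fin n → RatFun F) where
  toFun := g.val.mulVec
  invFun := g.inv.mulVec
  map_add' := Matrix.mulVec_add _
  map_smul' _ _ := Matrix.mulVec_smul _ _ _
  left_inv v := by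
    rw [Matrix.mulVec_mulVec, g.inv_val, Matrix.one_mulVec]
  right_inv v := by
    rw [Matrix.mulVec_mulVec, g.val_inv, Matrix.one_mulVec]

theorem colModule_mul (g : (Matrix (Fin n) (Fin n) (RatFun F))ˣ)
    (B : Matrix (Fin n) (Fin n) (RatFun F)) :
    colModule (g.val * B) = (colModule B).map
      (mulVecEquiv g : (Fin n → RatFun F) →ₗ[(proper F).op] (Fin n → RatFun F)) := by
  ext v
  constructor
  · rintro ⟨x, hx, rfl⟩
    exact ⟨B.mulVec x, ⟨x, hx, rfl⟩, Matrix.mulVec_mulVec x g.val B⟩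
  · rintro ⟨_, ⟨x, hx, rfl⟩, rfl⟩
    exact ⟨x, hx, Matrix.mulVec_mulVec x g.val B⟩

variable (F n) in
/-- The index `[g E : E]` of the standard lattice `E`, a homomorphism on the general linear
group. -/
def indexHom : (Matrix (Fin n) (Fin n) (RatFun F))ˣ →* Multiplicative ℤ where
  toFun g := Multiplicative.ofAdd (relIndex (colModule g.val) (colModule 1))
  map_one' := by
    rw [Units.val_one, relIndex_self]; rfl
  map_mul' g h := by
    -- `[ghE : E] = [ghE : gE] + [gE : E]`, and `[ghE : gE] = [hE : E]` by applying `g`.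
    rw [← ofAdd_add, ← relIndex_map (mulVecEquiv g) (colModule h.val), ← colModule_mul,
      ← colModule_mul, mul_one, add_comm, ← Units.val_mul,
      (isLattice_colModule (g * h).isUnit).relIndex_add (isLattice_colModule g.isUnit)
        (isLattice_colModule isUnit_one)]

theorem indexHom_apply (g : (Matrix (Fin n) (Fin n) (RatFun F))ˣ) :
    indexHom F n g = Multiplicative.ofAdd (relIndex (colModule g.val) (colModule 1)) := rfl

theorem indexHom_eq_one_of_colModule_eq {g : (Matrix (Fin n) (Fin n) (RatFun F))ˣ}
    (h : colModule g.val = colModule 1) : indexHom F n g = 1 := by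
  rw [indexHom_apply, h, relIndex_self]; rfl

theorem mulVec_mem_colModule_one {A : Matrix (Fin n) (Fin n) (RatFun F)}
    (hA : ∀ i j, A i j ∈ proper F) {x : Fin n → RatFun F} (hx : ∀ i, x i ∈ proper F) :
    A.mulVec x ∈ colModule (1 : Matrix (Fin n) (Fin n) (RatFun F)) :=
  mem_colModule_one.mpr fun i => by
    rw [Matrix.mulVec, dotProduct]
    exact sum_mem fun j _ => mul_mem (hA i j) (hx j)

/-- Since `x = gx + (1 - g)x`, one has `E ≤ gE + t⁻¹E`, and Nakayama gives `E ≤ gE`. -/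
theorem colModule_eq_of_residually_one {g : (Matrix (Fin n) (Fin n) (RatFun F))ˣ}
    (hg : ∀ i j, deg ((1 - g.val) i j) < 0) : colModule g.val = colModule 1 := by
  have hsub : ∀ i j, (1 - g.val) i j ∈ proper F := fun i j => (hg i j).le
  have hone : ∀ i j, (1 : Matrix (Fin n) (Fin n) (RatFun F)) i j ∈ proper F := fun i j => by
    rw [Matrix.one_apply]
    split_ifs
    exacts [one_mem _, zero_mem _]
  apply le_antisymm
  · rintro _ ⟨x, hx, rfl⟩
    refine mulVec_mem_colModule_one (fun i j => ?_) hx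
    have := sub_mem (hone i j) (hsub i j)
    rwa [Matrix.sub_apply, sub_sub_cancel] at this
  · refine le_of_le_sup_inv_t_smul (isLattice_colModule isUnit_one).1
      (isLattice_colModule g.isUnit).2 fun x hx => ?_
    have hx' := mem_colModule_one.mp hx
    refine Submodule.mem_sup.mpr ⟨g.val.mulVec x, ⟨x, hx', rfl⟩, (1 - g.val).mulVec x, ?_, ?_⟩
    · rw [Submodule.mem_smul_pointwise_iff_exists]
      refine ⟨t F • (1 - g.val).mulVec x, mem_colModule_one.mpr fun i => ?_,
        inv_smul_smul₀ t_ne_zero _⟩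
      change t F * ∑ j, (1 - g.val) i j * x j ∈ proper F
      rw [Finset.mul_sum]
      refine sum_mem fun j _ => ?_
      rw [← mul_assoc]
      exact mul_mem (t_mul_mem_proper (hg i j)) (hx' j)
    · rw [Matrix.sub_mulVec, Matrix.one_mulVec, add_sub_cancel]

variable (F n) in
/-- The diagonal matrices in the general linear group. -/
def diagUnits : (Fin n → (RatFun F)ˣ) →* (Matrix (Fin n) (Fin n) (RatFun F))ˣ :=
  (Units.map (Matrix.diagonalRingHom (Fin n) (RatFun F)).toMonoidHom).comp
    MulEquiv.piUnits.symm.toMonoidHom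

theorem diagUnits_val (d : Fin n → (RatFun F)ˣ) :
    (diagUnits F n d).val = Matrix.diagonal fun i => (d i : RatFun F) := rfl

theorem diagUnits_inv_val (d : Fin n → (RatFun F)ˣ) :
    (diagUnits F n d)⁻¹.val = Matrix.diagonal fun i => (d i : RatFun F)⁻¹ := by
  rw [← map_inv, diagUnits_val]
  simp

variable (F) in
/-- The indeterminate `t` as a unit of `F(t)`. -/
def tUnit : (RatFun F)ˣ := Units.mk0 (t F) t_ne_zero

theorem tUnit_zpow_val (k : ℤ) : ((tUnit F ^ k : (RatFun F)ˣ) : RatFun F) = t F ^ k := by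
  rw [Units.val_zpow_eq_zpow_val]; rfl

/-- A matrix with unit diagonal whose off-diagonal entries become small after conjugation with
powers of `t` has index `0`. -/
theorem indexHom_eq_one_of_conj {g : (Matrix (Fin n) (Fin n) (RatFun F))ˣ} (m : Fin n → ℤ)
    (hdiag : ∀ i, g.val i i = 1) (hg : ∀ i j, i ≠ j → deg (t F ^ (m i - m j) * g.val i j) < 0) :
    indexHom F n g = 1 := by
  set d := diagUnits F n fun i => tUnit F ^ m i with hd
  -- The target group is commutative, so the index is invariant under conjugation.
  have hconj : indexHom F n (d * g * d⁻¹) = indexHom F n g := by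
    rw [map_mul, map_mul, map_inv, mul_comm, inv_mul_cancel_left]
  rw [← hconj]
  apply indexHom_eq_one_of_colModule_eq
  apply colModule_eq_of_residually_one
  intro i j
  have h1 : (d * g * d⁻¹).val i j = t F ^ (m i - m j) * g.val i j := by
    rw [Units.val_mul, Units.val_mul, hd, diagUnits_inv_val, diagUnits_val, Matrix.mul_diagonal,
      Matrix.diagonal_mul, tUnit_zpow_val, tUnit_zpow_val, mul_assoc, ← zpow_neg,
      ← (commute_t_zpow (-m j) (g.val i j)).eq, ← mul_assoc, ← zpow_add₀ t_ne_zero, sub_eq_add_neg]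
  rw [Matrix.sub_apply, h1]
  by_cases hij : i = j
  · subst hij
    rw [hdiag, sub_self, zpow_zero, one_mul, Matrix.one_apply_eq, sub_self, deg_zero]
    exact WithBot.bot_lt_coe 0
  · rw [Matrix.one_apply_ne hij, zero_sub, deg_neg]
    exact hg i j hij

theorem exists_deg_t_zpow_mul_lt (g : Matrix (Fin n) (Fin n) (RatFun F)) :
    ∃ k : ℕ, ∀ (e : ℤ) i j, e ≤ -k → deg (t F ^ e * g i j) < 0 := by
  obtain ⟨k, hk⟩ := exists_inv_t_pow_mul_mem_forall fun p : Fin n × Fin n => g p.1 p.2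
  -- The extra one turns degree at most zero into negative degree.
  refine ⟨k + 1, fun e i j he => ?_⟩
  have h1 : t F ^ e * g i j = t F ^ (e + k) * ((t F)⁻¹ ^ k * g i j) := by
    rw [← mul_assoc, zpow_add₀ t_ne_zero, zpow_natCast, mul_assoc (t F ^ e), inv_pow,
      mul_inv_cancel₀ (pow_ne_zero _ t_ne_zero), mul_one]
  have h2 : deg ((t F)⁻¹ ^ k * g i j) ≤ 0 := hk (i, j)
  rw [h1, deg_mul, deg_t_zpow]
  refine (add_le_add_right h2 _).trans_lt ?_
  rw [add_zero]
  push_cast at he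
  exact WithBot.coe_lt_coe.mpr (by omega)

theorem indexHom_eq_one_of_lower {g : (Matrix (Fin n) (Fin n) (RatFun F))ˣ}
    (hdiag : ∀ i, g.val i i = 1) (hg : ∀ i j, i < j → g.val i j = 0) : indexHom F n g = 1 := by
  obtain ⟨k, hk⟩ := exists_deg_t_zpow_mul_lt g.val
  -- With these weights every entry below the diagonal is multiplied by a power of `t` with exponent
  -- at most `-k`.
  refine indexHom_eq_one_of_conj (fun i => -(k * (i : ℕ) : ℤ)) hdiag fun i j hij => ?_
  rcases lt_or_gt_of_ne hij with h | h
  · rw [hg i j h, mul_zero, deg_zero]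
    exact WithBot.bot_lt_coe 0
  · refine hk _ i j ?_
    have h' : ((j : ℕ) : ℤ) + 1 ≤ (i : ℕ) := by exact_mod_cast h
    nlinarith [Int.natCast_nonneg k]

theorem indexHom_eq_one_of_upper {g : (Matrix (Fin n) (Fin n) (RatFun F))ˣ}
    (hdiag : ∀ i, g.val i i = 1) (hg : ∀ i j, j < i → g.val i j = 0) : indexHom F n g = 1 := by
  obtain ⟨k, hk⟩ := exists_deg_t_zpow_mul_lt g.val
  refine indexHom_eq_one_of_conj (fun i => (k * (i : ℕ) : ℤ)) hdiag fun i j hij => ?_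
  rcases lt_or_gt_of_ne hij with h | h
  · refine hk _ i j ?_
    have h' : ((i : ℕ) : ℤ) + 1 ≤ (j : ℕ) := by exact_mod_cast h
    nlinarith [Int.natCast_nonneg k]
  · rw [hg i j h, mul_zero, deg_zero]
    exact WithBot.bot_lt_coe 0

theorem permMatrix_mulVec_apply (σ : Equiv.Perm (Fin n)) (x : Fin n → RatFun F) (i : Fin n) :
    (σ.permMatrix (RatFun F)).mulVec x i = x (σ i) := by
  rw [Matrix.mulVec, dotProduct, Finset.sum_eq_single (σ i)]
  · simp [Equiv.Perm.permMatrix, PEquiv.toMatrix_apply]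
  · intro j _ hj
    simp [Equiv.Perm.permMatrix, PEquiv.toMatrix_apply, hj.symm]
  · simp

theorem colModule_permMatrix (σ : Equiv.Perm (Fin n)) :
    colModule (σ.permMatrix (RatFun F)) = colModule 1 := by
  ext v
  rw [mem_colModule_one]
  constructor
  · rintro ⟨x, hx, rfl⟩ i
    rw [permMatrix_mulVec_apply]
    exact hx _
  · intro hv
    refine ⟨v ∘ σ.symm, fun i => hv _, ?_⟩
    funext i
    rw [permMatrix_mulVec_apply, Function.comp_apply, Equiv.symm_apply_apply]

theorem colModule_diagonal_of_deg_eq_zero {d : Fin n → RatFun F} (hd : ∀ i, deg (d i) = 0) :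
    colModule (Matrix.diagonal d) = colModule 1 := by
  ext v
  rw [mem_colModule_one]
  constructor
  · rintro ⟨x, hx, rfl⟩ i
    rw [Matrix.mulVec_diagonal]
    exact mul_mem (hd i).le (hx i)
  · intro hv
    refine ⟨fun i => (d i)⁻¹ * v i, fun i => mul_mem (inv_mem_proper (hd i)) (hv i), ?_⟩
    funext i
    have h0 : d i ≠ 0 := by
      intro h0
      have := hd i
      rw [h0, deg_zero] at this
      exact WithBot.bot_ne_coe this
    rw [Matrix.mulVec_diagonal, mul_inv_cancel_left₀ h0]

/-- The image of `E` is `E` with the vector `t eᵢ` adjoined, which is a cover of `E`. -/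
theorem indexHom_diagUnits_mulSingle (i : Fin n) :
    indexHom F n (diagUnits F n (Pi.mulSingle i (tUnit F))) = Multiplicative.ofAdd 1 := by
  have hx : (Pi.single i (t F) : Fin n → RatFun F) ∉
      colModule (1 : Matrix (Fin n) (Fin n) (RatFun F)) := by
    intro h
    have h1 := mem_colModule_one.mp h i
    rw [Pi.single_eq_same, mem_proper, deg_t] at h1
    exact absurd h1 (by norm_num)
  have hx' : (t F)⁻¹ • (Pi.single i (t F) : Fin n → RatFun F) = Pi.single i 1 := by
    funext j
    by_cases h : j = i
    · subst h
      rw [Pi.smul_apply, Pi.single_eq_same, Pi.single_eq_same]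
      exact inv_mul_cancel₀ (t_ne_zero (F := F))
    · simp [h]
  have hone : ∀ j, (Pi.single j 1 : Fin n → RatFun F) ∈
      colModule (1 : Matrix (Fin n) (Fin n) (RatFun F)) := fun j =>
    ⟨Pi.single j 1, fun l => by
      by_cases h : l = j
      · subst h; simp [one_mem]
      · simp [h, zero_mem], (Matrix.one_mulVec _).symm⟩
  have hcov := covBy_sup_span hx (hx' ▸ hone i)
  have hcol : ∀ j, (diagUnits F n (Pi.mulSingle i (tUnit F))).val.col j =
      if j = i then Pi.single i (t F) else Pi.single j 1 := by
    intro j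
    funext l
    rw [Matrix.col_apply, diagUnits_val, Matrix.diagonal_apply]
    by_cases hj : j = i
    · subst hj
      by_cases hl : l = j
      · subst hl; simp [tUnit]
      · simp [hl]
    · by_cases hl : l = j
      · subst hl; simp [hj]
      · simp [hj, hl]
  have heq : colModule (diagUnits F n (Pi.mulSingle i (tUnit F))).val =
      colModule 1 ⊔ Submodule.span (proper F).op {Pi.single i (t F)} := by
    rw [colModule_eq_span]
    have hmem := fun j => Submodule.subset_span (R := (proper F).op)
      (Set.mem_range_self (f := (diagUnits F n (Pi.mulSingle i (tUnit F))).val.col) j)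
    apply le_antisymm
    · rw [Submodule.span_le]
      rintro _ ⟨j, rfl⟩
      rw [hcol]
      split_ifs with hj
      · exact Submodule.mem_sup_right (Submodule.mem_span_singleton_self _)
      · exact Submodule.mem_sup_left (hone j)
    · refine sup_le ?_ ((Submodule.span_singleton_le_iff_mem _ _).mpr ?_)
      · rw [colModule_eq_span, Submodule.span_le]
        rintro _ ⟨j, rfl⟩
        have hj1 : (1 : Matrix (Fin n) (Fin n) (RatFun F)).col j = Pi.single j 1 := by
          funext l
          rw [Matrix.col_apply, Matrix.one_apply, Pi.single_apply]
        rw [hj1]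
        by_cases hj : j = i
        · subst hj
          have := inv_t_smul_mem (hmem j)
          rwa [hcol, if_pos rfl, hx'] at this
        · have := hmem j
          rwa [hcol, if_neg hj] at this
      · have := hmem i
        rwa [hcol, if_pos rfl] at this
  have hlat := isLattice_colModule (diagUnits F n (Pi.mulSingle i (tUnit F))).isUnit
  rw [heq] at hlat
  have hE : IsLattice (colModule (1 : Matrix (Fin n) (Fin n) (RatFun F))) :=
    isLattice_colModule isUnit_one
  rw [indexHom_apply, heq, hE.relIndex_of_covBy hlat hE hcov, relIndex_self, zero_add]

theorem degUnits_tUnit : degUnits F (tUnit F) = Multiplicative.ofAdd 1 := by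
  apply Multiplicative.toAdd.injective
  apply WithBot.coe_injective
  change ((WithBot.unbot _ _ : ℤ) : WithBot ℤ) = _
  rw [WithBot.coe_unbot]
  exact deg_t

theorem coe_toAdd_degUnits (u : (RatFun F)ˣ) :
    ((Multiplicative.toAdd (degUnits F u) : ℤ) : WithBot ℤ) = deg (u : RatFun F) :=
  WithBot.coe_unbot _ _

/-- Each entry is a power of `t` times an element of degree zero. The latter preserve `E`, and the
former are generated by the matrices with a single `t`. -/
theorem indexHom_diagUnits (d : Fin n → (RatFun F)ˣ) :
    indexHom F n (diagUnits F n d) = ∏ i, degUnits F (d i) := by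
  let P : (Fin n → Multiplicative ℤ) →* (Fin n → (RatFun F)ˣ) :=
    { toFun := fun e i => zpowersHom _ (tUnit F) (e i)
      map_one' := funext fun i => map_one _
      map_mul' := fun e f => funext fun i => map_mul _ _ _ }
  have hpow : ∀ e : Fin n → Multiplicative ℤ, indexHom F n (diagUnits F n (P e)) = ∏ i, e i := by
    intro e
    have h : (indexHom F n).comp ((diagUnits F n).comp P) =
        { toFun := fun e : Fin n → Multiplicative ℤ => ∏ i, e i
          map_one' := by simp
          map_mul' := fun e f => Finset.prod_mul_distrib } := by
      refine MonoidHom.functions_ext' _ _ _ fun i => MonoidHom.ext_mint ?_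
      have hP : P (Pi.mulSingle i (Multiplicative.ofAdd 1)) = Pi.mulSingle i (tUnit F) := by
        funext j
        change zpowersHom _ (tUnit F) 
          ((Pi.mulSingle i (Multiplicative.ofAdd 1) : Fin n → Multiplicative ℤ) j) = _
        by_cases hj : j = i
        · subst hj; simp
        · simp [hj]
      change indexHom F n (diagUnits F n (P (Pi.mulSingle i (Multiplicative.ofAdd 1)))) =
        ∏ j, (Pi.mulSingle i (Multiplicative.ofAdd 1) : Fin n → Multiplicative ℤ) j
      rw [hP, indexHom_diagUnits_mulSingle, Finset.prod_pi_mulSingle', if_pos (Finset.mem_univ i)]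
    exact DFunLike.congr_fun h e
  let e : Fin n → Multiplicative ℤ := fun i => degUnits F (d i)
  have hone : indexHom F n (diagUnits F n (d * (P e)⁻¹)) = 1 := by
    apply indexHom_eq_one_of_colModule_eq
    rw [diagUnits_val]
    apply colModule_diagonal_of_deg_eq_zero
    intro i
    have h1 : degUnits F ((d * (P e)⁻¹) i) = 1 := by
      change degUnits F (d i * (tUnit F ^ Multiplicative.toAdd (e i))⁻¹) = 1
      rw [map_mul, map_inv, map_zpow, degUnits_tUnit, ← ofAdd_zsmul, smul_eq_mul, mul_one,
        ofAdd_toAdd, mul_inv_cancel]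
    rw [← coe_toAdd_degUnits, h1]; rfl
  rw [map_mul, map_mul, map_inv, map_inv, hpow, mul_inv_eq_one] at hone
  exact hone

/-- A sign squares to one and `ℤ` has no torsion. -/
theorem degUnits_sign (s : ℤˣ) :
    degUnits F (Units.map (Int.castRingHom (RatFun F) : ℤ →* RatFun F) s) = 1 := by
  have h : (degUnits F (Units.map (Int.castRingHom (RatFun F) : ℤ →* RatFun F) s)) ^ 2 = 1 := by
    rw [← map_pow, ← map_pow, Int.units_sq, map_one, map_one]
  have h2 := congrArg Multiplicative.toAdd h
  rw [toAdd_pow, toAdd_one] at h2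
  apply Multiplicative.toAdd.injective
  rw [toAdd_one]
  simpa using h2

/-- In a Bruhat form only the diagonal factor contributes to either side. The argument works for
whichever form was chosen, so uniqueness of `D P` is not needed. -/
theorem degDet_eq_relIndex {P : Matrix (Fin n) (Fin n) (RatFun F)} (hP : IsUnit P) :
    degDet P = relIndex (colModule P) (colModule 1) := by
  have hex := exists_isBruhat hP
  obtain ⟨L, U, hB⟩ := hex.choose_spec
  rw [degDet, dieudonneDet, dif_pos hex, map_mul, Abelianization.lift_apply_of, degUnits_sign,
    one_mul, map_prod]
  simp only [Abelianization.lift_apply_of]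
  generalize hex.choose = x at hB
  have hPu := hP
  rw [hB.eq, IsUnit.mul_iff, IsUnit.mul_iff, IsUnit.mul_iff] at hPu
  obtain ⟨⟨⟨⟨gL, rfl⟩, -⟩, ⟨gP, hgP⟩⟩, ⟨gU, rfl⟩⟩ := hPu
  have hprod : P = (gL * diagUnits F n x.1 * gP * gU).val := by
    rw [Units.val_mul, Units.val_mul, Units.val_mul, diagUnits_val, hgP]
    exact hB.eq
  have h1 := indexHom_apply (gL * diagUnits F n x.1 * gP * gU)
  rw [← hprod, map_mul, map_mul, map_mul, indexHom_eq_one_of_lower hB.lower_diag hB.lower_zero,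
    indexHom_eq_one_of_upper hB.upper_diag hB.upper_zero,
    indexHom_eq_one_of_colModule_eq (g := gP) (by rw [hgP, colModule_permMatrix]), one_mul,
    mul_one, mul_one, indexHom_diagUnits] at h1
  rw [h1, toAdd_ofAdd]

theorem latticeDeg_eq_relIndex {L : RightSubmodule F n} (hL : IsLattice L) :
    latticeDeg L = relIndex L (colModule 1) := by
  have hex := hL.exists_eq_colModule
  rw [latticeDeg, dif_pos hex, degDet_eq_relIndex hex.choose_spec.1, ← hex.choose_spec.2]

/-- Scaling by `t` is the diagonal matrix with all `n` entries `t`, whose index is `n`. -/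
theorem latticeDeg_t_smul {L : RightSubmodule F n} (hL : IsLattice L) :
    IsLattice (t F • L) ∧ latticeDeg (t F • L) = latticeDeg L + n := by
  obtain ⟨P, hP, rfl⟩ := hL.exists_eq_colModule
  obtain ⟨g, rfl⟩ := hP
  have heq : t F • colModule g.val =
      colModule (diagUnits F n (fun _ => tUnit F) * g).val := by
    rw [Units.val_mul, colModule_mul, Submodule.pointwise_smul_def]
    ext v
    simp only [Submodule.mem_map]
    refine exists_congr fun w => and_congr_right fun _ => ?_
    have : mulVecEquiv (diagUnits F n fun _ => tUnit F) w = t F • w := by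
      funext i
      change (diagUnits F n fun _ => tUnit F).val.mulVec w i = _
      rw [diagUnits_val, Matrix.mulVec_diagonal]
      rfl
    rw [LinearEquiv.coe_coe, this]
    rfl
  have hl := isLattice_colModule (diagUnits F n (fun _ => tUnit F) * g).isUnit
  rw [heq]
  refine ⟨hl, ?_⟩
  rw [latticeDeg_eq_relIndex hl, latticeDeg_eq_relIndex hL]
  have h1 := map_mul (indexHom F n) (diagUnits F n fun _ => tUnit F) g
  rw [indexHom_diagUnits, indexHom_apply, indexHom_apply, Finset.prod_const, degUnits_tUnit,
    Finset.card_univ, Fintype.card_fin] at h1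
  have h2 := congrArg Multiplicative.toAdd h1
  rw [toAdd_mul, toAdd_pow, toAdd_ofAdd, toAdd_ofAdd, toAdd_ofAdd] at h2
  rw [h2]
  simp [add_comm]

end SkewRat

/-- In an order with a rank function `f`, a maximal chain from `bot` to `top` meets every rank. -/
theorem IsMaxChain.ncard_eq_of_rank {α : Type*} [PartialOrder α] {f : α → ℤ} (hf : StrictMono f)
    (hcov : ∀ a b, a ⋖ b → f b = f a + 1) {bot top : α} (hbot : ∀ a, bot ≤ a)
    (htop : ∀ a, a ≤ top) {C : Set α} (hC : IsMaxChain (· ≤ ·) C) :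
    (C.ncard : ℤ) = f top - f bot + 1 := by
  have hle : ∀ a ∈ C, ∀ b ∈ C, f a ≤ f b → a ≤ b := by
    intro a ha b hb hab
    rcases hC.1.total ha hb with h | h
    · exact h
    · rcases h.lt_or_eq with h | h
      · exact absurd (hf h) (not_lt.mpr hab)
      · exact h.ge
  have hinj : Set.InjOn f C := fun a ha b hb hab =>
    le_antisymm (hle a ha b hb hab.le) (hle b hb a ha hab.ge)
  have hmaps : Set.MapsTo f C (Set.Icc (f bot) (f top)) := fun a _ =>
    ⟨hf.monotone (hbot a), hf.monotone (htop a)⟩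
  have hfin : C.Finite := Set.Finite.of_injOn hmaps hinj (Set.finite_Icc _ _)
  -- Maximality: whatever is comparable with the whole chain belongs to it.
  have hmem : ∀ c, (∀ z ∈ C, z ≤ c ∨ c ≤ z) → c ∈ C := by
    intro c hc
    have hins : IsChain (· ≤ ·) (insert c C) := hC.1.insert fun z hz _ => (hc z hz).symm
    rw [hC.2 hins (Set.subset_insert c C)]
    exact Set.mem_insert c C
  have himg : f '' C = Set.Icc (f bot) (f top) := by
    refine Set.Subset.antisymm hmaps.image_subset fun d hd => ?_
    by_contra hd'
    -- If rank `d` were skipped, the chain elements `a`, `b` nearest to it would differ in rank by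
    -- at least two. An element strictly between them would then belong to the chain and contradict
    -- the choice of `a` or `b`.
    obtain ⟨a, ⟨haC, had⟩, hamax⟩ := Set.exists_max_image {a ∈ C | f a ≤ d} f
      (hfin.subset (Set.sep_subset _ _)) ⟨bot, hmem bot fun z _ => Or.inr (hbot z), hd.1⟩
    obtain ⟨b, ⟨hbC, hbd⟩, hbmin⟩ := Set.exists_min_image {a ∈ C | d ≤ f a} f
      (hfin.subset (Set.sep_subset _ _)) ⟨top, hmem top fun z _ => Or.inl (htop z), hd.2⟩
    have had' : f a < d := lt_of_le_of_ne had fun h => hd' ⟨a, haC, h⟩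
    have hbd' : d < f b := lt_of_le_of_ne hbd fun h => hd' ⟨b, hbC, h.symm⟩
    have hab : a < b := lt_of_le_of_ne (hle a haC b hbC (had'.trans hbd').le) fun h => by
      rw [h] at had'
      exact lt_asymm had' hbd'
    have hncov : ¬ a ⋖ b := fun h => by
      have := hcov a b h
      omega
    obtain ⟨c, hac, hcb⟩ := exists_lt_lt_of_not_covBy hab hncov
    have hcC : c ∈ C := by
      refine hmem c fun z hz => ?_
      rcases le_total (f z) d with h | h
      · exact Or.inl ((hle z hz a haC (hamax z ⟨hz, h⟩)).trans hac.le)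
      · exact Or.inr (hcb.le.trans (hle b hbC z hz (hbmin z ⟨hz, h⟩)))
    rcases le_total (f c) d with h | h
    · exact absurd (hf hac) (not_lt.mpr (hamax c ⟨hcC, h⟩))
    · exact absurd (hf hcb) (not_lt.mpr (hbmin c ⟨hcC, h⟩))
  rw [← hinj.ncard_image, himg, Set.ncard_eq_toFinset_card', Set.toFinset_Icc,
    Int.card_Icc]
  have := hf.monotone (hbot top)
  omega

/-! ### The ascending operator and the degree on full-rank free submodules. -/

namespace SkewRat

open Submodule

variable {F : Type*} [DivisionRing F] {n : ℕ}

theorem t_smul_inv_t_smul (L : RightSubmodule F n) : t F • (t F)⁻¹ • L = L :=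
  smul_inv_smul₀ t_ne_zero L

theorem inv_t_smul_t_smul (L : RightSubmodule F n) : (t F)⁻¹ • t F • L = L :=
  inv_smul_smul₀ t_ne_zero L

theorem le_t_smul (L : RightSubmodule F n) : L ≤ t F • L := by
  have := smul_mono_right (t F) (inv_t_pow_smul_le L 1)
  rwa [pow_one, t_smul_inv_t_smul] at this

theorem IsLattice.inv_t_smul {L : RightSubmodule F n} (hL : IsLattice L) :
    IsLattice ((t F)⁻¹ • L) := by
  refine ⟨hL.1.map _, fun v => ?_⟩
  obtain ⟨k, hk⟩ := hL.2 v
  refine ⟨k + 1, ?_⟩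
  rw [pow_succ', mul_smul]
  exact Submodule.smul_mem_pointwise_smul _ _ _ hk

/-- The sum `L + t⁻¹M` is `L` or `M`; the latter would give `M ≤ L` by Nakayama. -/
theorem IsLattice.le_t_smul_of_covBy {L M : RightSubmodule F n} (hL : IsLattice L)
    (hM : IsLattice M) (h : L ⋖ M) : M ≤ t F • L := by
  have hle : L ⊔ (t F)⁻¹ • M ≤ M := sup_le h.le (by simpa using inv_t_pow_smul_le M 1)
  rcases h.eq_or_eq le_sup_left hle with h1 | h1
  · have h2 : (t F)⁻¹ • M ≤ L := le_sup_right.trans h1.le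
    have h3 := smul_mono_right (t F) h2
    rwa [t_smul_inv_t_smul] at h3
  · exact absurd (le_of_le_sup_inv_t_smul hM.1 hL.2 h1.ge) h.lt.not_ge

/-- Every vector of `tL` outside `L` lies in a cover of `L`. -/
theorem IsLattice.t_smul_le_of_forall_covBy {L N : RightSubmodule F n} (hL : IsLattice L)
    (hN : ∀ M, IsLattice M → L ⋖ M → M ≤ N) : t F • L ≤ N := by
  obtain ⟨htL, hdeg⟩ := latticeDeg_t_smul hL
  -- For `n = 0` there are no covers and the hypothesis on `N` is empty, but the space is zero. For
  -- `n > 0` some cover exists, which yields `L ≤ N`.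
  rcases Nat.eq_zero_or_pos n with rfl | hn
  · intro x _
    rw [Subsingleton.elim x 0]
    exact N.zero_mem
  have hlt : L < t F • L := lt_of_le_of_ne (le_t_smul L) fun h => by
    rw [← h] at hdeg
    omega
  have hspan : ∀ x ∈ t F • L, IsLattice (L ⊔ Submodule.span (proper F).op {x}) := fun x hx =>
    hL.of_mem_Icc htL le_sup_left
      (sup_le hlt.le ((Submodule.span_singleton_le_iff_mem _ _).mpr hx))
  have hLN : L ≤ N := by
    obtain ⟨x, hx, hcov⟩ := hL.exists_covBy_le hlt
    exact le_sup_left.trans (hN _ (hspan x hx) hcov)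
  intro x hx
  by_cases hxL : x ∈ L
  · exact hLN hxL
  have hx' : (t F)⁻¹ • x ∈ L := by
    have := Submodule.smul_mem_pointwise_smul x (t F)⁻¹ _ hx
    rwa [inv_t_smul_t_smul] at this
  exact hN _ (hspan x hx) (covBy_sup_span hxL hx')
    (Submodule.mem_sup_right (Submodule.mem_span_singleton_self x))

theorem FullRankFree.isLattice (L : FullRankFree F n) : IsLattice L.1 :=
  isFullRankFree_iff_isLattice.mp L.2

/-- A submodule between two lattices is a lattice, so no intermediate terms are lost. -/
theorem FullRankFree.covBy_iff {L M : FullRankFree F n} : L ⋖ M ↔ L.1 ⋖ M.1 := by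
  refine ⟨fun h => ⟨h.lt, fun N hLN hNM => ?_⟩, fun h => ⟨h.lt, fun N hLN hNM => h.2 hLN hNM⟩⟩
  have hN : IsFullRankFree N := isFullRankFree_iff_isLattice.mpr
    (L.isLattice.of_mem_Icc M.isLattice hLN.le hNM.le)
  exact h.2 (c := ⟨N, hN⟩) hLN hNM

theorem FullRankFree.latticeDeg_strictMono :
    StrictMono fun L : FullRankFree F n => latticeDeg L.1 := fun L M h => by
  change latticeDeg L.1 < latticeDeg M.1
  rw [latticeDeg_eq_relIndex L.isLattice, latticeDeg_eq_relIndex M.isLattice]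
  exact L.isLattice.relIndex_lt M.isLattice (isLattice_colModule isUnit_one) h

theorem FullRankFree.latticeDeg_of_covBy {L M : FullRankFree F n} (h : L ⋖ M) :
    latticeDeg M.1 = latticeDeg L.1 + 1 := by
  rw [latticeDeg_eq_relIndex L.isLattice, latticeDeg_eq_relIndex M.isLattice]
  exact L.isLattice.relIndex_of_covBy M.isLattice (isLattice_colModule isUnit_one)
    (FullRankFree.covBy_iff.mp h)

theorem FullRankFree.latticeDeg_add (L M : FullRankFree F n) :
    latticeDeg L.1 + latticeDeg M.1 = latticeDeg (L.1 ⊓ M.1) + latticeDeg (L.1 ⊔ M.1) := by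
  rw [latticeDeg_eq_relIndex L.isLattice, latticeDeg_eq_relIndex M.isLattice,
    latticeDeg_eq_relIndex (L.isLattice.inf M.isLattice),
    latticeDeg_eq_relIndex (L.isLattice.sup M.isLattice)]
  exact L.isLattice.relIndex_inf_sup M.isLattice (isLattice_colModule isUnit_one)

variable (F n) in
/-- Multiplication by `t` as an automorphism of the order of full-rank free submodules. -/
def tSmulIso : FullRankFree F n ≃o FullRankFree F n where
  toFun L := ⟨t F • L.1, isFullRankFree_iff_isLattice.mpr (latticeDeg_t_smul L.isLattice).1⟩
  invFun L := ⟨(t F)⁻¹ • L.1, isFullRankFree_iff_isLattice.mpr L.isLattice.inv_t_smul⟩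
  left_inv L := Subtype.ext (inv_t_smul_t_smul L.1)
  right_inv L := Subtype.ext (t_smul_inv_t_smul L.1)
  map_rel_iff' {L M} := by
    change t F • L.1 ≤ t F • M.1 ↔ L.1 ≤ M.1
    refine ⟨fun h => ?_, fun h => smul_mono_right (t F) h⟩
    have := smul_mono_right (t F)⁻¹ h
    rwa [inv_t_smul_t_smul, inv_t_smul_t_smul] at this

theorem isLUB_tSmulIso (L : FullRankFree F n) :
    IsLUB {M : FullRankFree F n | L ⋖ M} (tSmulIso F n L) := by
  refine ⟨fun M hM => L.isLattice.le_t_smul_of_covBy M.isLattice (FullRankFree.covBy_iff.mp hM),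
    fun N hN => L.isLattice.t_smul_le_of_forall_covBy fun M hM hLM => ?_⟩
  exact hN (a := ⟨M, isFullRankFree_iff_isLattice.mpr hM⟩) (FullRankFree.covBy_iff.mpr hLM)

end SkewRat

end

/-! ### The main theorem. -/

theorem lemma3p2 (F : Type*) [DivisionRing F] (n : ℕ) :
    ∃ (hsup : ∀ ⦃L M : SkewRat.RightSubmodule F n⦄, SkewRat.IsFullRankFree L →
        SkewRat.IsFullRankFree M → SkewRat.IsFullRankFree (L ⊔ M))
      (hinf : ∀ ⦃L M : SkewRat.RightSubmodule F n⦄, SkewRat.IsFullRankFree L →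
        SkewRat.IsFullRankFree M → SkewRat.IsFullRankFree (L ⊓ M)),
      letI : Lattice (SkewRat.FullRankFree F n) := Subtype.lattice hsup hinf
      IsUniformModularLattice (SkewRat.FullRankFree F n) ∧
      (∀ L : SkewRat.FullRankFree F n,
        (∃ P : Matrix (Fin n) (Fin n) (SkewRat.RatFun F),
          IsUnit P ∧ L.1 = SkewRat.colModule P) ∧
        ∀ P : Matrix (Fin n) (Fin n) (SkewRat.RatFun F),
          IsUnit P → L.1 = SkewRat.colModule P → SkewRat.latticeDeg L.1 = SkewRat.degDet P) ∧
      IsUnitValuation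
        (fun L : SkewRat.FullRankFree F n => ((SkewRat.latticeDeg L.1 : ℤ) : ℝ)) ∧
      HasUniformRank (SkewRat.FullRankFree F n) n ∧
      ∀ L : SkewRat.FullRankFree F n,
        ∃ h : SkewRat.IsFullRankFree (SkewRat.t F • L.1),
          IsLUB {M : SkewRat.FullRankFree F n | L ⋖ M} ⟨SkewRat.t F • L.1, h⟩ := by
  have hsup : ∀ ⦃L M : SkewRat.RightSubmodule F n⦄, SkewRat.IsFullRankFree L →
      SkewRat.IsFullRankFree M → SkewRat.IsFullRankFree (L ⊔ M) := fun L M hL hM => by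
    rw [SkewRat.isFullRankFree_iff_isLattice] at hL hM ⊢
    exact hL.sup hM
  have hinf : ∀ ⦃L M : SkewRat.RightSubmodule F n⦄, SkewRat.IsFullRankFree L →
      SkewRat.IsFullRankFree M → SkewRat.IsFullRankFree (L ⊓ M) := fun L M hL hM => by
    rw [SkewRat.isFullRankFree_iff_isLattice] at hL hM ⊢
    exact hL.inf hM
  let : Lattice (SkewRat.FullRankFree F n) := Subtype.lattice hsup hinf
  refine ⟨hsup, hinf, ?_, ?_, ?_, ?_, ?_⟩
  · refine ⟨fun x y z h => Subtype.ext (sup_inf_assoc_of_le y.1 h).symm, fun x y C hC hchain => ?_,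
      SkewRat.tSmulIso F n, SkewRat.isLUB_tSmulIso⟩
    have hmono := SkewRat.FullRankFree.latticeDeg_strictMono (F := F) (n := n)
    -- The degree embeds a chain of the interval into a finite interval of integers.
    refine Set.Finite.of_injOn (f := fun L : SkewRat.FullRankFree F n => SkewRat.latticeDeg L.1)
      (t := Set.Icc (SkewRat.latticeDeg x.1) (SkewRat.latticeDeg y.1))
      (fun L hL => ⟨hmono.monotone (hC hL).1, hmono.monotone (hC hL).2⟩)
      (fun L hL M hM hLM => ?_) (Set.finite_Icc _ _)
    rcases hchain.total hL hM with h | h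
    · exact h.eq_of_not_lt fun hlt => (hmono hlt).ne hLM
    · exact (h.eq_of_not_lt fun hlt => (hmono hlt).ne hLM.symm).symm
  · refine fun L => ⟨L.isLattice.exists_eq_colModule, fun P hP hLP => ?_⟩
    rw [SkewRat.degDet_eq_relIndex hP, ← hLP, SkewRat.latticeDeg_eq_relIndex L.isLattice]
  · refine ⟨fun L M => ?_, fun L M h => ?_, fun L M h => ?_⟩
    · exact_mod_cast SkewRat.FullRankFree.latticeDeg_add L M
    · exact_mod_cast SkewRat.FullRankFree.latticeDeg_strictMono h
    · rw [SkewRat.FullRankFree.latticeDeg_of_covBy h]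
      push_cast
      ring
  · intro x y hy C hC
    obtain rfl := hy.unique (SkewRat.isLUB_tSmulIso x)
    have hxy : x ≤ SkewRat.tSmulIso F n x := SkewRat.le_t_smul x.1
    have h := hC.ncard_eq_of_rank
      (f := fun L : Set.Icc x (SkewRat.tSmulIso F n x) => SkewRat.latticeDeg L.1.1)
      (fun L M h => SkewRat.FullRankFree.latticeDeg_strictMono h)
      -- Intervals are convex, so a cover inside the interval is a cover in the whole lattice.
      (fun L M h => SkewRat.FullRankFree.latticeDeg_of_covBy ⟨h.lt, fun N hLN hNM =>
        h.2 (c := ⟨N, L.2.1.trans hLN.le, hNM.le.trans M.2.2⟩) hLN hNM⟩)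
      (bot := ⟨x, le_rfl, hxy⟩) (top := ⟨SkewRat.tSmulIso F n x, hxy, le_rfl⟩)
      (fun L => L.2.1) (fun L => L.2.2)
    have hdeg := (SkewRat.latticeDeg_t_smul x.isLattice).2
    change (C.ncard : ℤ) = SkewRat.latticeDeg (SkewRat.t F • x.1) - SkewRat.latticeDeg x.1 + 1 at h
    omega
  · exact fun L => ⟨(SkewRat.tSmulIso F n L).2, SkewRat.isLUB_tSmulIso L⟩
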